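/- **Notation.** Let $d\in\mathbb N$ and let $\lambda=(\lambda_1,\dots,\lambda_d)$ be a Young diagram with $n=\sum_i\lambda_i$ boxes, numbered $1,\dots,n$ along the rows, starting with the top row; put $\lambda_{d+1}=0$. The group $S(n)$ acts on $(\mathbb C^d)^{\otimes n}$ by $\psi_1\otimes\dots\otimes\psi_n\mapsto\psi_{\tau^{-1}(1)}\otimes\dots\otimes\psi_{\tau^{-1}(n)}$. Let $p_\lambda=\sum_\sigma\sigma$ over the permutations leaving the rows of $\lambda$ invariant, $q_\lambda=\sum_\tau\mathrm{sgn}(\tau)\tau$ over those leaving its columns invariant, $y_\lambda=q_\lambda p_\lambda$, and let $\mathcal H_\lambda=y_\lambda(\mathbb C^d)^{\otimes n}$, the irreducible representation space of $SU(d)$ attached to $\lambda$, with the inner product of $(\mathbb C^d)^{\otimes n}$. For $\mathbf m=(m_{i,j})_{1\le i<j\le d}$ with $m_{i,j}\in\mathbb N$ put $|\mathbf m|=\sum_{i<j}m_{i,j}$, let $f_{\mathbf m}$ be the tensor product of standard basis vectors of $\mathbb C^d$ read along the rows of the tableau of shape $\lambda$ with nondecreasing rows whose row $i$ contains $m_{i,j}$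 times the entry $j$ for each $j>i$ and otherwise the entry $i$, and let $|\mathbf m,\lambda\rangle=y_\lambda f_{\mathbf m}/\|y_\lambda f_{\mathbf m}\|$. Let $\mathcal F$ be the multimode Fock space of $d(d-1)/2$ oscillators, with orthonormal number basis $|\mathbf m\rangle$ and vacuum $|\mathbf 0\rangle$. **Lemma.** Let $\eta<2/9$ and $\delta>0$, and suppose that $\lambda_i-\lambda_{i+1}\ge\delta n$ for all $1\le i\le d$. Then for $n>n_0(\eta,\delta,d)$ there exists an isometry $V_\lambda:\mathcal H_\lambda\to\mathcal F$ such that $V_\lambda|\mathbf 0,\lambda\rangle=|\mathbf 0\rangle$ and, for all $\mathbf m\neq\mathbf 0$ with $|\mathbf m|\le n^\eta$, $$\langle\mathbf m|\,V_\lambda=\frac{1}{\sqrt{1+(\tilde C n)^{(9\eta-2)/12}/\delta^{1/3}}}\;\langle\mathbf m,\lambda| ,$$ where $\tilde C=\tilde C(\eta,d)>0$ is a constant depending only on $\eta$ and $d$. More precisely, $n_0$ can be taken of the form $(C(d)/\delta^2)^{1/(1-3\eta)}$ with a constant $C(d)>0$ depending only on $d$. -/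

import Mathlib

noncomputable section

namespace SchurWeylFock

/-- The modes (oscillators) are labelled by the pairs `i < j` of elements of `{0, …, d - 1}`. -/
abbrev Mode (d : ℕ) : Type := {p : Fin d × Fin d // p.1 < p.2}

/-- Collections `𝐦 = (m_{i,j})_{i < j}` of natural numbers. -/
abbrev Occ (d : ℕ) : Type := Mode d → ℕ

/-- The entry `m_{i,j}`, extended by `0` to the pairs with `j ≤ i`. -/
def Occ.entry {d : ℕ} (m : Occ d) (i j : Fin d) : ℕ :=
  if h : i < j then m ⟨(i, j), h⟩ else 0

/-- `|𝐦| = ∑_{i < j} m_{i,j}`. -/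
def Occ.size {d : ℕ} (m : Occ d) : ℕ := ∑ p, m p

/-- The multimode Fock space of the `d (d - 1) / 2` oscillators: the square summable complex
families indexed by the occupation numbers. -/
abbrev Fock (d : ℕ) : Type := lp (fun _ : Occ d => ℂ) 2

/-- The number vector `|𝐦⟩` of the Fock space; the vacuum is `|𝟎⟩`. -/
def Fock.number {d : ℕ} (m : Occ d) : Fock d := lp.single 2 m (1 : ℂ)

/-! A diagram with (at most) `d` rows is given by its row lengths `lam : Fin d → ℕ`.
It has `∑ i, lam i` boxes. -/

variable {d : ℕ}

/-- The length of row `i` (rows are counted from `0`), which is `0` for `i ≥ d`. -/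
def rowLength (lam : Fin d → ℕ) (i : ℕ) : ℕ := if h : i < d then lam ⟨i, h⟩ else 0

/-- The row of the `k`-th box, the boxes being numbered along the rows, from left to right,
starting with the top row. -/
def boxRow (lam : Fin d → ℕ) (k : Fin (∑ i, lam i)) : Fin d := (finSigmaFinEquiv.symm k).1

/-- The column (counted from `0`) of the `k`-th box. -/
def boxCol (lam : Fin d → ℕ) (k : Fin (∑ i, lam i)) : ℕ := ((finSigmaFinEquiv.symm k).2 : ℕ)

/-- The tensor power `(ℂ^d)^{⊗ n}`, as the Hilbert space with orthonormal basis
`f_{a(1)} ⊗ ⋯ ⊗ f_{a(n)}`, where `a` runs through the words of length `n`. -/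
abbrev TensorPow (d n : ℕ) : Type := EuclideanSpace ℂ (Fin n → Fin d)

/-- The basis vector `f_a = f_{a(1)} ⊗ ⋯ ⊗ f_{a(n)}`. -/
def basisVec {n : ℕ} (a : Fin n → Fin d) : TensorPow d n := EuclideanSpace.single a (1 : ℂ)

/-- The permutation `τ` acts on the tensor power by `f_a ↦ f_{a ∘ τ⁻¹}`, that is, by
`ψ_1 ⊗ ⋯ ⊗ ψ_n ↦ ψ_{τ⁻¹(1)} ⊗ ⋯ ⊗ ψ_{τ⁻¹(n)}`. -/
def permAct {n : ℕ} (τ : Equiv.Perm (Fin n)) : TensorPow d n →ₗ[ℂ] TensorPow d n :=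
  (LinearIsometryEquiv.piLpCongrLeft 2 ℂ ℂ
    (Equiv.arrowCongr τ (Equiv.refl (Fin d)))).toLinearEquiv.toLinearMap

theorem permAct_basisVec {n : ℕ} (τ : Equiv.Perm (Fin n)) (a : Fin n → Fin d) :
    permAct τ (basisVec a) = basisVec (a ∘ τ.symm) := by
  simp only [permAct, basisVec, LinearEquiv.coe_coe, LinearIsometryEquiv.coe_toLinearEquiv,
    EuclideanSpace.piLpCongrLeft_single]
  rfl

/-- The permutations of the boxes that leave every row invariant. -/
def rowPerms (lam : Fin d → ℕ) : Finset (Equiv.Perm (Fin (∑ i, lam i))) :=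
  {σ | ∀ k, boxRow lam (σ k) = boxRow lam k}

/-- The permutations of the boxes that leave every column invariant. -/
def colPerms (lam : Fin d → ℕ) : Finset (Equiv.Perm (Fin (∑ i, lam i))) :=
  {τ | ∀ k, boxCol lam (τ k) = boxCol lam k}

/-- The row symmetriser `p_λ = ∑ σ`, over the row permutations. -/
def rowSym (lam : Fin d → ℕ) : TensorPow d (∑ i, lam i) →ₗ[ℂ] TensorPow d (∑ i, lam i) :=
  ∑ σ ∈ rowPerms lam, permAct σ

/-- The column antisymmetriser `q_λ = ∑ sgn(τ) τ`, over the column permutations. -/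
def colAntisym (lam : Fin d → ℕ) : TensorPow d (∑ i, lam i) →ₗ[ℂ] TensorPow d (∑ i, lam i) :=
  ∑ τ ∈ colPerms lam, ((Equiv.Perm.sign τ : ℤ) : ℂ) • permAct τ

/-- The Young symmetriser `y_λ = q_λ p_λ`. -/
def youngSym (lam : Fin d → ℕ) : TensorPow d (∑ i, lam i) →ₗ[ℂ] TensorPow d (∑ i, lam i) :=
  colAntisym lam ∘ₗ rowSym lam

/-- The irreducible representation space `ℋ_λ = y_λ (ℂ^d)^{⊗ n}`, with the inner product of
`(ℂ^d)^{⊗ n}`. -/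
abbrev Irrep (lam : Fin d → ℕ) : Submodule ℂ (TensorPow d (∑ i, lam i)) :=
  LinearMap.range (youngSym lam)

/-- The content of the box in row `i` and column `c` in the tableau with nondecreasing rows in
which row `i` contains `m_{i,j}` times the entry `j`, for each `j > i`, and otherwise the entry
`i`: it is the largest `j > i` such that the box belongs to the last `∑_{l ≥ j} m_{i,l}` boxes of
the row, and `i` if there is no such `j`. -/
def tableauEntry (lam : Fin d → ℕ) (m : Occ d) (i : Fin d) (c : ℕ) : Fin d :=
  (insert i (Finset.univ.filter fun j : Fin d =>
    i < j ∧ lam i ≤ c + ∑ l ∈ Finset.Ici j, m.entry i l)).max' (Finset.insert_nonempty _ _)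

/-- The word obtained by reading this tableau along the rows, starting with the top row. -/
def tableauWord (lam : Fin d → ℕ) (m : Occ d) : Fin (∑ i, lam i) → Fin d :=
  fun k => tableauEntry lam m (boxRow lam k) (boxCol lam k)

/-- The vector `y_λ f_𝐦` of `ℋ_λ`. -/
def youngVec (lam : Fin d → ℕ) (m : Occ d) : Irrep lam :=
  (youngSym lam).rangeRestrict (basisVec (tableauWord lam m))

/-- The normalised vector `|𝐦, λ⟩ = y_λ f_𝐦 / ‖y_λ f_𝐦‖` of `ℋ_λ`. -/
def ket (lam : Fin d → ℕ) (m : Occ d) : Irrep lam :=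
  ((‖youngVec lam m‖⁻¹ : ℝ) : ℂ) • youngVec lam m

end SchurWeylFock

end

/-!
The vector `y_λ f_𝐦` is, up to a positive factor, the sum of the column antisymmetrised words
`q_λ f_a` over the fillings `a` in the row orbit of the tableau of `𝐦`. Such a word vanishes unless
the entries of each column of `a` are distinct, its squared norm is then the number of column
permutations, and two of them are orthogonal unless corresponding columns have the same contents.
In all fillings considered the entries are at least their row numbers, and `|𝐦|` entries are
misplaced, that is, different from their row numbers.

Call *clusters* the columns with at least two misplaced entries, and split `y_λ f_𝐦` according to
the number `κ P` of occurrences of each cluster `P`. A column with at most one misplaced entry is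
determined by its content (`eq_of_content_eq`), so that the contents of the columns and `κ`
determine `𝐦` (`eq_of_mem_part`): for fixed `κ` the parts of different `𝐦` are orthogonal. The parts
with clusters are small: moving a misplaced entry from a cluster to one of the `δ n` trivial columns
that end in its row shows that each excess misplaced entry costs a factor `2 |𝐦|² / (δ n)` in the
number of fillings (`card_level_succ_mul_le`), while at most `|𝐦| ^ |κ|` fillings share the contents
of their columns (`card_sameContent_le`). Hence the part `κ` has norm at most `z ^ |κ|` times that
of the whole vector, where `z² = 2 n ^ (3 η - 1) / δ`, and summing over `κ` bounds the synthesis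
operator of the family `|𝐦, λ⟩` by `(1 - z) ^ (-d ^ d)` (`norm_sum_ket_le`).

When `z` is small, this bound is at most `√(1 + 4 d ^ d z)`, hence at most the square root in the
statement. Therefore `ψ ↦ ⟨𝐦, λ | ψ⟩`, divided by this square root for `𝐦 ≠ 𝟎`, is a contraction, and
it extends to an isometry into the Fock space, as only finitely many of the infinitely many number
states have been used (`exists_isometry_of_sum_le`); for `d = 1`, both spaces are lines.
-/

noncomputable section

namespace SchurWeylFock

variable {d : ℕ}

/-! ### Columns with misplaced entries -/

/-- The number of entries of a column `P` that differ from their row number. -/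
def defect (P : Fin d → Fin d) : ℕ := (Finset.univ.filter fun r => P r ≠ r).card

/-- The number of times that the entry `v` occurs in the column `P`. -/
def content (P : Fin d → Fin d) (v : Fin d) : ℕ := (Finset.univ.filter fun r => P r = v).card

theorem defect_eq_zero {P : Fin d → Fin d} : defect P = 0 ↔ P = id := by
  simp [defect, Finset.filter_eq_empty_iff, funext_iff]

theorem sum_eq_of_content_eq {P P' : Fin d → Fin d} (h : content P = content P') :
    ∑ r, (P r : ℕ) = ∑ r, (P' r : ℕ) := by
  have key : ∀ P : Fin d → Fin d, ∑ r, (P r : ℕ) = ∑ v, content P v * (v : ℕ) := by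
    intro P
    rw [← Finset.sum_fiberwise Finset.univ P (fun r => (P r : ℕ))]
    refine Finset.sum_congr rfl fun v _ => ?_
    rw [Finset.sum_congr rfl (g := fun _ => (v : ℕ))]
    · simp [content]
    · intro r hr
      rw [(Finset.mem_filter.1 hr).2]
  rw [key, key, h]

/-- The entries of a column that dominates the trivial column and has the same content have the
same sum, so that they agree. -/
theorem eq_id_of_content_eq {P : Fin d → Fin d} (hP : ∀ r, r ≤ P r)
    (h : content P = content id) : P = id := by
  have h1 := sum_eq_of_content_eq h
  have h2 := (Finset.sum_eq_sum_iff_of_le (s := Finset.univ) (f := fun r : Fin d => (r : ℕ))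
    (g := fun r => (P r : ℕ)) (fun r _ => hP r)).1 h1.symm
  funext r
  exact Fin.ext (h2 r (Finset.mem_univ r)).symm

theorem eq_of_defect_le_one {P : Fin d → Fin d} (h : defect P ≤ 1) {i r : Fin d}
    (hi : P i ≠ i) (hr : r ≠ i) : P r = r := by
  by_contra hc
  exact hr (Finset.card_le_one.1 h r (by simpa using hc) i (by simpa using hi))

/-- Columns with at most one misplaced entry are determined by their content: the row of the
misplaced entry is the value that is missing, and the sum of the column gives the entry. -/
theorem eq_of_content_eq {P P' : Fin d → Fin d} (hP : ∀ r, r ≤ P r) (hP' : ∀ r, r ≤ P' r)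
    (h1 : defect P ≤ 1) (h1' : defect P' ≤ 1) (h : content P = content P') : P = P' := by
  by_cases hid : P = id
  · subst hid
    exact (eq_id_of_content_eq hP' h.symm).symm
  by_cases hid' : P' = id
  · subst hid'
    exact eq_id_of_content_eq hP h
  obtain ⟨i, hi⟩ : ∃ i, P i ≠ i := by simpa [funext_iff] using hid
  obtain ⟨i', hi'⟩ : ∃ i, P' i ≠ i := by simpa [funext_iff] using hid'
  have h0 : content P i = 0 := by
    simp only [content, Finset.card_eq_zero, Finset.filter_eq_empty_iff, Finset.mem_univ,
      true_implies]
    intro r hr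
    by_cases hri : r = i
    · exact hi (hri ▸ hr)
    · exact hri ((eq_of_defect_le_one h1 hi hri).symm.trans hr)
  have hii : i = i' := by
    by_contra hne
    rw [h] at h0
    have := eq_of_defect_le_one h1' hi' hne
    simp only [content, Finset.card_eq_zero, Finset.filter_eq_empty_iff, Finset.mem_univ,
      true_implies] at h0
    exact h0 this
  subst hii
  have hne : ∀ r, r ≠ i → P r = P' r := fun r hr =>
    (eq_of_defect_le_one h1 hi hr).trans (eq_of_defect_le_one h1' hi' hr).symm
  have hs := sum_eq_of_content_eq h
  rw [← Finset.add_sum_erase _ _ (Finset.mem_univ i),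
    ← Finset.add_sum_erase _ (fun r => (P' r : ℕ)) (Finset.mem_univ i)] at hs
  rw [Finset.sum_congr rfl (g := fun r => (P' r : ℕ)) fun r hr => by
    rw [hne r (Finset.ne_of_mem_erase hr)]] at hs
  funext r
  by_cases hr : r = i
  · subst hr
    exact Fin.ext (Nat.add_right_cancel hs)
  · exact hne r hr

/-! ### Boxes and columns -/

variable {lam : Fin d → ℕ}

/-- The number of the box in row `r` and column `c`. -/
def box (lam : Fin d → ℕ) (r : Fin d) (c : ℕ) (h : c < lam r) : Fin (∑ i, lam i) :=
  finSigmaFinEquiv ⟨r, ⟨c, h⟩⟩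

@[simp]
theorem boxRow_box (r : Fin d) (c : ℕ) (h : c < lam r) : boxRow lam (box lam r c h) = r := by
  simp [boxRow, box]

@[simp]
theorem boxCol_box (r : Fin d) (c : ℕ) (h : c < lam r) : boxCol lam (box lam r c h) = c := by
  unfold boxCol box
  rw [Equiv.symm_apply_apply]

theorem boxCol_lt (k : Fin (∑ i, lam i)) : boxCol lam k < lam (boxRow lam k) :=
  (finSigmaFinEquiv.symm k).2.2

@[simp]
theorem box_boxRow_boxCol (k : Fin (∑ i, lam i)) (h : boxCol lam k < lam (boxRow lam k)) :
    box lam (boxRow lam k) (boxCol lam k) h = k := by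
  simp [box, boxRow, boxCol]

theorem box_ext {k l : Fin (∑ i, lam i)} (hr : boxRow lam k = boxRow lam l)
    (hc : boxCol lam k = boxCol lam l) : k = l := by
  have h1 := box_boxRow_boxCol k (boxCol_lt k)
  have h2 := box_boxRow_boxCol l (boxCol_lt l)
  rw [← h1, ← h2]
  congr 1

theorem row_le_sum (r : Fin d) : lam r ≤ ∑ i, lam i :=
  Finset.single_le_sum (f := lam) (fun _ _ => Nat.zero_le _) (Finset.mem_univ r)

theorem boxCol_mem_range (k : Fin (∑ i, lam i)) :
    boxCol lam k ∈ Finset.range (∑ i, lam i) :=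
  Finset.mem_range.2 ((boxCol_lt k).trans_le (row_le_sum _))

/-- The column `c` of the filling of the diagram by the word `a`, continued below the diagram by
the row numbers. -/
def col (lam : Fin d → ℕ) (a : Fin (∑ i, lam i) → Fin d) (c : ℕ) (r : Fin d) : Fin d :=
  if h : c < lam r then a (box lam r c h) else r

theorem col_of_lt (a : Fin (∑ i, lam i) → Fin d) {c : ℕ} {r : Fin d} (h : c < lam r) :
    col lam a c r = a (box lam r c h) := dif_pos h

theorem col_of_le (a : Fin (∑ i, lam i) → Fin d) {c : ℕ} {r : Fin d} (h : lam r ≤ c) :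
    col lam a c r = r := dif_neg h.not_gt

@[simp]
theorem col_boxCol_boxRow (a : Fin (∑ i, lam i) → Fin d) (k : Fin (∑ i, lam i)) :
    col lam a (boxCol lam k) (boxRow lam k) = a k := by
  rw [col_of_lt a (boxCol_lt k), box_boxRow_boxCol]

theorem eq_of_col_eq {a b : Fin (∑ i, lam i) → Fin d}
    (h : ∀ c ∈ Finset.range (∑ i, lam i), col lam a c = col lam b c) : a = b := by
  funext k
  rw [← col_boxCol_boxRow a k, ← col_boxCol_boxRow b k, h _ (boxCol_mem_range k)]

/-- The entries of the word `a` are at least their row numbers. -/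
def Dominates (lam : Fin d → ℕ) (a : Fin (∑ i, lam i) → Fin d) : Prop :=
  ∀ k, boxRow lam k ≤ a k

theorem Dominates.le_col {a : Fin (∑ i, lam i) → Fin d} (ha : Dominates lam a) (c : ℕ)
    (r : Fin d) : r ≤ col lam a c r := by
  by_cases h : c < lam r
  · rw [col_of_lt a h]
    simpa using ha (box lam r c h)
  · rw [col_of_le a (not_lt.1 h)]

/-- The number of times that the entry `j` occurs in row `i`. -/
def rowCount (lam : Fin d → ℕ) (a : Fin (∑ i, lam i) → Fin d) (i j : Fin d) : ℕ :=
  (Finset.univ.filter fun k => boxRow lam k = i ∧ a k = j).card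

theorem card_col_eq (a : Fin (∑ i, lam i) → Fin d) {i j : Fin d} (hij : i ≠ j) :
    ((Finset.range (∑ i, lam i)).filter fun c => col lam a c i = j).card = rowCount lam a i j := by
  refine (Finset.card_bij (fun k _ => boxCol lam k) ?_ ?_ ?_).symm
  · intro k hk
    obtain ⟨h1, h2⟩ := (Finset.mem_filter.1 hk).2
    refine Finset.mem_filter.2 ⟨boxCol_mem_range k, ?_⟩
    rw [← h1, col_boxCol_boxRow, h2]
  · intro k hk l hl h
    exact box_ext ((Finset.mem_filter.1 hk).2.1.trans (Finset.mem_filter.1 hl).2.1.symm) h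
  · intro c hc
    have h2 := (Finset.mem_filter.1 hc).2
    have hlt : c < lam i := by
      by_contra hge
      exact hij ((col_of_le a (not_lt.1 hge)).symm.trans h2)
    exact ⟨box lam i c hlt, by simp [← col_of_lt a hlt, h2], by simp⟩

/-- The words whose columns have the same contents. -/
def SameContent (lam : Fin d → ℕ) (a b : Fin (∑ i, lam i) → Fin d) : Prop :=
  ∀ c, content (col lam a c) = content (col lam b c)

theorem sameContent_of_colPerm {a : Fin (∑ i, lam i) → Fin d} {τ : Equiv.Perm (Fin (∑ i, lam i))}
    (hτ : τ ∈ colPerms lam) : SameContent lam (a ∘ τ) a := by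
  have hτ' : ∀ k, boxCol lam (τ k) = boxCol lam k := by simpa [colPerms] using hτ
  have key : ∀ (b : Fin (∑ i, lam i) → Fin d) (c : ℕ) (v : Fin d), content (col lam b c) v =
      (Finset.univ.filter fun k => boxCol lam k = c ∧ b k = v).card +
        (Finset.univ.filter fun r : Fin d => lam r ≤ c ∧ r = v).card := by
    intro b c v
    rw [content, ← Finset.card_filter_add_card_filter_not (fun r => c < lam r)]
    congr 1
    · refine (Finset.card_bij (fun k _ => boxRow lam k) ?_ ?_ ?_).symm
      · intro k hk
        obtain ⟨h1, h2⟩ := (Finset.mem_filter.1 hk).2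
        have := boxCol_lt k
        subst h1
        simp [h2, this]
      · intro k hk l hl h
        exact box_ext h ((Finset.mem_filter.1 hk).2.1.trans (Finset.mem_filter.1 hl).2.1.symm)
      · intro r hr
        simp only [Finset.mem_filter, Finset.mem_univ, true_and] at hr
        exact ⟨box lam r c hr.2, by simp [← col_of_lt b hr.2, hr.1], by simp⟩
    · congr 1
      ext r
      simp only [Finset.mem_filter, Finset.mem_univ, true_and, not_lt]
      constructor
      · rintro ⟨h1, h2⟩
        rw [col_of_le b h2] at h1
        exact ⟨h2, h1⟩
      · rintro ⟨h1, h2⟩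
        rw [col_of_le b h1]
        exact ⟨h2, h1⟩
  intro c
  funext v
  rw [key, key]
  congr 1
  refine Finset.card_bij (fun k _ => τ k) ?_ (fun _ _ _ _ h => τ.injective h) ?_
  · intro k hk
    simpa [hτ'] using hk
  · intro k hk
    refine ⟨τ.symm k, ?_, by simp⟩
    have := hτ' (τ.symm k)
    rw [Equiv.apply_symm_apply] at this
    simpa [← this] using hk

/-! ### Tableaux -/

theorem Occ.entry_of_lt (m : Occ d) {i j : Fin d} (h : i < j) : m.entry i j = m ⟨(i, j), h⟩ :=
  dif_pos h

theorem Occ.entry_of_le (m : Occ d) {i j : Fin d} (h : j ≤ i) : m.entry i j = 0 :=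
  dif_neg h.not_gt

theorem Occ.ext_entry {m l : Occ d} (h : ∀ i j, i < j → m.entry i j = l.entry i j) : m = l := by
  funext ⟨⟨i, j⟩, hij⟩
  have := h i j hij
  rwa [Occ.entry_of_lt _ hij, Occ.entry_of_lt _ hij] at this

theorem Occ.size_eq (m : Occ d) : m.size = ∑ i, ∑ j, m.entry i j := by
  rw [← Fintype.sum_prod_type', Occ.size]
  rw [← Finset.sum_subset (Finset.subset_univ (Finset.univ.filter fun p : Fin d × Fin d =>
    p.1 < p.2))]
  · rw [← Finset.sum_subtype_eq_sum_filter]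
    refine Finset.sum_congr (by simp) fun p _ => ?_
    rw [Occ.entry_of_lt m p.2]
  · intro p _ hp
    exact Occ.entry_of_le m (by simpa using hp)

theorem dominates_tableauWord (m : Occ d) : Dominates lam (tableauWord lam m) := fun _ =>
  Finset.le_max' _ _ (Finset.mem_insert_self _ _)

theorem tableauEntry_eq_iff (m : Occ d) {i j : Fin d} (hij : i < j) {c : ℕ} (hc : c < lam i) :
    tableauEntry lam m i c = j ↔ lam i ≤ c + ∑ l ∈ Finset.Ici j, m.entry i l ∧
      c + ∑ l ∈ Finset.Ioi j, m.entry i l < lam i := by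
  unfold tableauEntry
  constructor
  · intro h
    have h1 := Finset.max'_mem (insert i (Finset.univ.filter fun j : Fin d =>
      i < j ∧ lam i ≤ c + ∑ l ∈ Finset.Ici j, m.entry i l)) (Finset.insert_nonempty _ _)
    rw [h, Finset.mem_insert] at h1
    rcases h1 with h1 | h1
    · exact absurd h1 hij.ne'
    refine ⟨(Finset.mem_filter.1 h1).2.2, ?_⟩
    by_contra hge
    have hlt : (j : ℕ) + 1 < d := by
      by_contra hd
      have : Finset.Ioi j = ∅ := by
        ext x
        simp only [Finset.mem_Ioi, Finset.notMem_empty, iff_false, not_lt]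
        exact Fin.le_def.2 (by omega)
      rw [this] at hge
      simp at hge
      omega
    have heq : Finset.Ioi j = Finset.Ici (⟨j + 1, hlt⟩ : Fin d) := by
      ext x
      rw [Finset.mem_Ioi, Finset.mem_Ici, Fin.lt_def, Fin.le_def, Nat.succ_le_iff]
    have h2 := Finset.le_max' (insert i (Finset.univ.filter fun j : Fin d =>
      i < j ∧ lam i ≤ c + ∑ l ∈ Finset.Ici j, m.entry i l)) (⟨j + 1, hlt⟩ : Fin d)
      (Finset.mem_insert_of_mem (by
        rw [heq] at hge
        simp only [Finset.mem_filter, Finset.mem_univ, true_and]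
        exact ⟨hij.trans (Fin.lt_def.2 (Nat.lt_succ_self _)), not_lt.1 hge⟩))
    rw [h, Fin.le_def] at h2
    simp at h2
  · rintro ⟨h1, h2⟩
    refine le_antisymm (Finset.max'_le _ _ _ fun x hx => ?_)
      (Finset.le_max' _ _ (Finset.mem_insert_of_mem (by simp [hij, h1])))
    rcases Finset.mem_insert.1 hx with rfl | hx
    · exact hij.le
    · by_contra hlt
      have h3 := (Finset.mem_filter.1 hx).2.2
      have h4 : ∑ l ∈ Finset.Ici x, m.entry i l ≤ ∑ l ∈ Finset.Ioi j, m.entry i l :=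
        Finset.sum_le_sum_of_subset fun y hy => Finset.mem_Ioi.2
          ((not_le.1 hlt).trans_le (Finset.mem_Ici.1 hy))
      omega

theorem rowCount_tableauWord (m : Occ d) {i j : Fin d} (hij : i < j) (hm : m.size ≤ lam i) :
    rowCount lam (tableauWord lam m) i j = m.entry i j := by
  have h1 : ∑ l ∈ Finset.Ici j, m.entry i l = m.entry i j + ∑ l ∈ Finset.Ioi j, m.entry i l := by
    rw [← Finset.Ioi_insert, Finset.sum_insert (by simp)]
  have h2 : ∑ l ∈ Finset.Ici j, m.entry i l ≤ lam i := by
    refine le_trans ?_ hm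
    rw [Occ.size_eq]
    exact (Finset.sum_le_sum_of_subset (Finset.subset_univ _)).trans
      (Finset.single_le_sum (f := fun i => ∑ j, m.entry i j) (fun _ _ => Nat.zero_le _)
        (Finset.mem_univ i))
  have h3 : rowCount lam (tableauWord lam m) i j = (Finset.Ico
      (lam i - ∑ l ∈ Finset.Ici j, m.entry i l) (lam i - ∑ l ∈ Finset.Ioi j, m.entry i l)).card := by
    refine Finset.card_bij (fun k _ => boxCol lam k) ?_ ?_ ?_
    · intro k hk
      obtain ⟨h4, h5⟩ := (Finset.mem_filter.1 hk).2
      have h6 := boxCol_lt k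
      rw [tableauWord, h4] at h5
      rw [h4] at h6
      have := (tableauEntry_eq_iff m hij h6).1 h5
      rw [Finset.mem_Ico]
      omega
    · intro k hk l hl h
      exact box_ext ((Finset.mem_filter.1 hk).2.1.trans (Finset.mem_filter.1 hl).2.1.symm) h
    · intro c hc
      rw [Finset.mem_Ico] at hc
      have hlt : c < lam i := by omega
      refine ⟨box lam i c hlt, ?_, by simp⟩
      refine Finset.mem_filter.2 ⟨Finset.mem_univ _, boxRow_box i c hlt, ?_⟩
      rw [tableauWord, boxRow_box, boxCol_box]
      exact (tableauEntry_eq_iff m hij hlt).2 (by omega)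
  rw [h3, Nat.card_Ico]
  omega

/-! ### Row orbits -/

/-- The words that arise from `w` by permutations of the rows. -/
def rowOrbit (lam : Fin d → ℕ) (w : Fin (∑ i, lam i) → Fin d) :
    Finset (Fin (∑ i, lam i) → Fin d) :=
  (rowPerms lam).image fun σ => w ∘ σ.symm

theorem mem_rowPerms {σ : Equiv.Perm (Fin (∑ i, lam i))} :
    σ ∈ rowPerms lam ↔ ∀ k, boxRow lam (σ k) = boxRow lam k := by
  simp [rowPerms]

theorem mem_colPerms {σ : Equiv.Perm (Fin (∑ i, lam i))} :
    σ ∈ colPerms lam ↔ ∀ k, boxCol lam (σ k) = boxCol lam k := by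
  simp [colPerms]

theorem symm_mem_rowPerms {σ : Equiv.Perm (Fin (∑ i, lam i))} (h : σ ∈ rowPerms lam) :
    σ.symm ∈ rowPerms lam := by
  rw [mem_rowPerms] at h ⊢
  intro k
  have := h (σ.symm k)
  rwa [Equiv.apply_symm_apply, eq_comm] at this

theorem symm_mem_colPerms {σ : Equiv.Perm (Fin (∑ i, lam i))} (h : σ ∈ colPerms lam) :
    σ.symm ∈ colPerms lam := by
  rw [mem_colPerms] at h ⊢
  intro k
  have := h (σ.symm k)
  rwa [Equiv.apply_symm_apply, eq_comm] at this

theorem mul_mem_rowPerms {σ τ : Equiv.Perm (Fin (∑ i, lam i))} (hσ : σ ∈ rowPerms lam)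
    (hτ : τ ∈ rowPerms lam) : σ * τ ∈ rowPerms lam := by
  rw [mem_rowPerms] at *
  intro k
  rw [Equiv.Perm.mul_apply, hσ, hτ]

theorem mul_mem_colPerms {σ τ : Equiv.Perm (Fin (∑ i, lam i))} (hσ : σ ∈ colPerms lam)
    (hτ : τ ∈ colPerms lam) : σ * τ ∈ colPerms lam := by
  rw [mem_colPerms] at *
  intro k
  rw [Equiv.Perm.mul_apply, hσ, hτ]

theorem self_mem_rowOrbit (w : Fin (∑ i, lam i) → Fin d) : w ∈ rowOrbit lam w :=
  Finset.mem_image.2 ⟨1, by simp [mem_rowPerms], rfl⟩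

theorem comp_mem_rowOrbit {w a : Fin (∑ i, lam i) → Fin d} (ha : a ∈ rowOrbit lam w)
    {σ : Equiv.Perm (Fin (∑ i, lam i))} (hσ : σ ∈ rowPerms lam) : a ∘ σ ∈ rowOrbit lam w := by
  obtain ⟨ρ, hρ, rfl⟩ := Finset.mem_image.1 ha
  exact Finset.mem_image.2 ⟨σ.symm * ρ, mul_mem_rowPerms (symm_mem_rowPerms hσ) hρ, rfl⟩

theorem Dominates.of_mem_rowOrbit {w a : Fin (∑ i, lam i) → Fin d} (hw : Dominates lam w)
    (ha : a ∈ rowOrbit lam w) : Dominates lam a := by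
  obtain ⟨ρ, hρ, rfl⟩ := Finset.mem_image.1 ha
  intro k
  rw [← mem_rowPerms.1 (symm_mem_rowPerms hρ) k]
  exact hw _

theorem rowCount_of_mem_rowOrbit {w a : Fin (∑ i, lam i) → Fin d} (ha : a ∈ rowOrbit lam w)
    (i j : Fin d) : rowCount lam a i j = rowCount lam w i j := by
  obtain ⟨ρ, hρ, rfl⟩ := Finset.mem_image.1 ha
  have h := mem_rowPerms.1 (symm_mem_rowPerms hρ)
  refine Finset.card_bij (fun k _ => ρ.symm k) ?_ (fun _ _ _ _ h => ρ.symm.injective h) ?_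
  · intro k hk
    simpa [h] using hk
  · intro k hk
    exact ⟨ρ k, by simpa [mem_rowPerms.1 hρ] using hk, by simp⟩

theorem card_rowPerms_comp_eq (w : Fin (∑ i, lam i) → Fin d)
    {a : Fin (∑ i, lam i) → Fin d} (ha : a ∈ rowOrbit lam w) :
    ((rowPerms lam).filter fun σ => w ∘ σ.symm = a).card =
      ((rowPerms lam).filter fun σ => w ∘ σ.symm = w).card := by
  obtain ⟨ρ, hρ, rfl⟩ := Finset.mem_image.1 ha
  refine Finset.card_bij (fun σ _ => ρ⁻¹ * σ) ?_ (fun _ _ _ _ h => mul_left_cancel h) ?_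
  · intro σ hσ
    obtain ⟨h1, h2⟩ := Finset.mem_filter.1 hσ
    refine Finset.mem_filter.2 ⟨mul_mem_rowPerms (symm_mem_rowPerms hρ) h1, ?_⟩
    funext k
    have := congrFun h2 (ρ k)
    rwa [Function.comp_apply, Function.comp_apply, Equiv.symm_apply_apply] at this
  · intro σ hσ
    obtain ⟨h1, h2⟩ := Finset.mem_filter.1 hσ
    refine ⟨ρ * σ, Finset.mem_filter.2 ⟨mul_mem_rowPerms hρ h1, ?_⟩, inv_mul_cancel_left ρ σ⟩
    funext k
    exact congrFun h2 (ρ.symm k)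

theorem exists_rowSym_basisVec (w : Fin (∑ i, lam i) → Fin d) :
    ∃ M : ℕ, 0 < M ∧ rowSym lam (basisVec w) = (M : ℂ) • ∑ a ∈ rowOrbit lam w, basisVec a := by
  have h0 : (1 : Equiv.Perm (Fin (∑ i, lam i))) ∈ (rowPerms lam).filter fun σ => w ∘ σ.symm = w :=
    Finset.mem_filter.2 ⟨by simp [mem_rowPerms], rfl⟩
  refine ⟨_, Finset.card_pos.2 ⟨1, h0⟩, ?_⟩
  have h1 : rowSym lam (basisVec w) =
      ∑ σ ∈ rowPerms lam, (basisVec (w ∘ σ.symm) : TensorPow d (∑ i, lam i)) := by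
    rw [rowSym, LinearMap.sum_apply]
    exact Finset.sum_congr rfl fun σ _ => permAct_basisVec σ w
  rw [h1, ← Finset.sum_fiberwise_of_maps_to (t := rowOrbit lam w)
    fun σ hσ => Finset.mem_image_of_mem (fun σ : Equiv.Perm (Fin (∑ i, lam i)) => w ∘ σ.symm) hσ,
    Finset.smul_sum]
  refine Finset.sum_congr rfl fun a ha => ?_
  rw [← card_rowPerms_comp_eq w ha, Nat.cast_smul_eq_nsmul, ← Finset.sum_const]
  exact Finset.sum_congr rfl fun σ hσ => congrArg basisVec (Finset.mem_filter.1 hσ).2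

/-! ### Antisymmetrised words -/

/-- The columns of the filling by the word `a` have distinct entries. -/
def ColInjective (lam : Fin d → ℕ) (a : Fin (∑ i, lam i) → Fin d) : Prop :=
  ∀ k l, boxCol lam k = boxCol lam l → a k = a l → k = l

theorem inner_basisVec {n : ℕ} (a b : Fin n → Fin d) :
    inner ℂ (basisVec a) (basisVec b) = if a = b then (1 : ℂ) else 0 := by
  simp [basisVec, EuclideanSpace.inner_single_left]

theorem colAntisym_basisVec (a : Fin (∑ i, lam i) → Fin d) :
    colAntisym lam (basisVec a) =
      ∑ τ ∈ colPerms lam, ((Equiv.Perm.sign τ : ℤ) : ℂ) • basisVec (a ∘ τ.symm) := by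
  simp [colAntisym, permAct_basisVec]

theorem colAntisym_eq_zero {a : Fin (∑ i, lam i) → Fin d} (ha : ¬ ColInjective lam a) :
    colAntisym lam (basisVec a) = 0 := by
  obtain ⟨k, l, hc, hv, hne⟩ : ∃ k l, boxCol lam k = boxCol lam l ∧ a k = a l ∧ k ≠ l := by
    simpa [ColInjective] using ha
  have hs : Equiv.swap k l ∈ colPerms lam := by
    rw [mem_colPerms]
    intro x
    by_cases h1 : x = k
    · subst h1; simp [hc]
    by_cases h2 : x = l
    · subst h2; simp [hc]
    rw [Equiv.swap_apply_of_ne_of_ne h1 h2]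
  have has : a ∘ Equiv.swap k l = a := by
    funext x
    by_cases h1 : x = k
    · subst h1; simp [hv]
    by_cases h2 : x = l
    · subst h2; simp [hv]
    simp [Equiv.swap_apply_of_ne_of_ne h1 h2]
  rw [colAntisym_basisVec]
  refine Finset.sum_involution (fun τ _ => τ * Equiv.swap k l) ?_ ?_ ?_ ?_
  · intro τ _
    have : a ∘ (τ * Equiv.swap k l).symm = a ∘ τ.symm := by
      funext x
      exact congrFun has (τ.symm x)
    rw [this, Equiv.Perm.sign_mul, Equiv.Perm.sign_swap hne, ← add_smul]
    simp
  · intro τ _ _ h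
    have : Equiv.swap k l = 1 := by simpa using h
    exact hne (Equiv.swap_eq_one_iff.1 this)
  · intro τ hτ
    exact mul_mem_colPerms hτ hs
  · intro τ _
    simp [mul_assoc]

theorem inner_colAntisym (a b : Fin (∑ i, lam i) → Fin d) :
    inner ℂ (colAntisym lam (basisVec a)) (colAntisym lam (basisVec b)) =
      ∑ σ ∈ colPerms lam, ∑ τ ∈ colPerms lam, ((Equiv.Perm.sign σ : ℤ) : ℂ) *
        ((Equiv.Perm.sign τ : ℤ) : ℂ) * if a ∘ σ.symm = b ∘ τ.symm then 1 else 0 := by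
  rw [colAntisym_basisVec, colAntisym_basisVec, sum_inner]
  refine Finset.sum_congr rfl fun σ _ => ?_
  rw [inner_sum]
  refine Finset.sum_congr rfl fun τ _ => ?_
  rw [inner_smul_left, inner_smul_right, inner_basisVec]
  simp

theorem inner_colAntisym_eq_zero {a b : Fin (∑ i, lam i) → Fin d} (h : ¬ SameContent lam a b) :
    inner ℂ (colAntisym lam (basisVec a)) (colAntisym lam (basisVec b)) = (0 : ℂ) := by
  rw [inner_colAntisym]
  refine Finset.sum_eq_zero fun σ hσ => Finset.sum_eq_zero fun τ hτ => ?_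
  rw [if_neg, mul_zero]
  intro he
  apply h
  have h1 := sameContent_of_colPerm (a := a) (symm_mem_colPerms hσ)
  have h2 := sameContent_of_colPerm (a := b) (symm_mem_colPerms hτ)
  intro c
  rw [← h1 c, he, h2 c]

theorem inner_colAntisym_self {a : Fin (∑ i, lam i) → Fin d} (ha : ColInjective lam a) :
    inner ℂ (colAntisym lam (basisVec a)) (colAntisym lam (basisVec a)) =
      ((colPerms lam).card : ℂ) := by
  rw [inner_colAntisym, Finset.card_eq_sum_ones, Nat.cast_sum]
  refine Finset.sum_congr rfl fun σ hσ => ?_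
  rw [Finset.sum_eq_single_of_mem σ hσ]
  · rcases Int.units_eq_one_or (Equiv.Perm.sign σ) with h | h <;> simp [h]
  · intro τ hτ hne
    rw [if_neg, mul_zero]
    intro he
    apply hne
    have h1 := mem_colPerms.1 (symm_mem_colPerms hσ)
    have h2 := mem_colPerms.1 (symm_mem_colPerms hτ)
    have h3 : σ.symm = τ.symm := Equiv.ext fun k =>
      ha _ _ ((h1 k).trans (h2 k).symm) (congrFun he k)
    exact (Equiv.symm_bijective.injective h3).symm

theorem norm_sq_colAntisym {a : Fin (∑ i, lam i) → Fin d} (ha : ColInjective lam a) :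
    ‖colAntisym lam (basisVec a)‖ ^ 2 = (colPerms lam).card := by
  have := inner_colAntisym_self ha
  rw [inner_self_eq_norm_sq_to_K] at this
  apply Complex.ofReal_injective
  push_cast
  exact this

/-! ### Counting fillings -/

/-- The fillings obtained by permuting the rows of the tableau of `𝐦`. -/
def fillings (lam : Fin d → ℕ) (m : Occ d) : Finset (Fin (∑ i, lam i) → Fin d) :=
  rowOrbit lam (tableauWord lam m)

theorem dominates_of_mem_fillings {m : Occ d} {a : Fin (∑ i, lam i) → Fin d}
    (ha : a ∈ fillings lam m) : Dominates lam a :=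
  (dominates_tableauWord m).of_mem_rowOrbit ha

theorem card_col_eq_entry {m : Occ d} (hm : ∀ i, m.size ≤ lam i) {a : Fin (∑ i, lam i) → Fin d}
    (ha : a ∈ fillings lam m) {i j : Fin d} (hij : i < j) :
    ((Finset.range (∑ i, lam i)).filter fun c => col lam a c i = j).card = m.entry i j := by
  rw [card_col_eq a hij.ne, rowCount_of_mem_rowOrbit ha, rowCount_tableauWord m hij (hm i)]

theorem sum_defect {m : Occ d} (hm : ∀ i, m.size ≤ lam i) {a : Fin (∑ i, lam i) → Fin d}
    (ha : a ∈ fillings lam m) :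
    ∑ c ∈ Finset.range (∑ i, lam i), defect (col lam a c) = m.size := by
  have hdom := dominates_of_mem_fillings ha
  have h1 : ∀ c, defect (col lam a c) =
      ∑ i, ∑ j, if i < j then (if col lam a c i = j then 1 else 0) else 0 := by
    intro c
    rw [defect, Finset.card_filter]
    refine Finset.sum_congr rfl fun i _ => ?_
    rw [Finset.sum_eq_single_of_mem (col lam a c i) (Finset.mem_univ _)]
    · have := hdom.le_col c i
      rcases this.eq_or_lt with h | h
      · simp [← h]
      · simp [h, h.ne']
    · intro j _ hj
      simp [hj.symm]
  rw [Finset.sum_congr rfl fun c _ => h1 c, Finset.sum_comm, Occ.size_eq]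
  refine Finset.sum_congr rfl fun i _ => ?_
  rw [Finset.sum_comm]
  refine Finset.sum_congr rfl fun j _ => ?_
  by_cases hij : i < j
  · simp only [hij, if_true]
    rw [← card_col_eq_entry hm ha hij, Finset.card_filter]
  · simp [hij, Occ.entry_of_le m (not_lt.1 hij)]

/-- The nontrivial columns of a filling. -/
def movedCols (lam : Fin d → ℕ) (a : Fin (∑ i, lam i) → Fin d) : Finset ℕ :=
  (Finset.range (∑ i, lam i)).filter fun c => col lam a c ≠ id

theorem card_movedCols_le {m : Occ d} (hm : ∀ i, m.size ≤ lam i) {a : Fin (∑ i, lam i) → Fin d}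
    (ha : a ∈ fillings lam m) : (movedCols lam a).card ≤ m.size := by
  rw [← sum_defect hm ha, movedCols, Finset.card_filter]
  refine Finset.sum_le_sum fun c _ => ?_
  split_ifs with h
  · exact Nat.one_le_iff_ne_zero.2 fun h0 => h (defect_eq_zero.1 h0)
  · exact Nat.zero_le _

/-- The exchange of the boxes of row `i` in the columns `c` and `c'`. -/
def boxSwap (lam : Fin d → ℕ) (i : Fin d) (c c' : ℕ) : Equiv.Perm (Fin (∑ i, lam i)) :=
  if h : c < lam i ∧ c' < lam i then Equiv.swap (box lam i c h.1) (box lam i c' h.2) else 1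

theorem boxSwap_boxSwap (i : Fin d) (c c' : ℕ) (k : Fin (∑ i, lam i)) :
    boxSwap lam i c c' (boxSwap lam i c c' k) = k := by
  unfold boxSwap
  split_ifs <;> simp

theorem boxSwap_mem_rowPerms (i : Fin d) (c c' : ℕ) : boxSwap lam i c c' ∈ rowPerms lam := by
  rw [mem_rowPerms]
  intro k
  unfold boxSwap
  split_ifs with h
  · by_cases h1 : k = box lam i c h.1
    · simp [h1]
    by_cases h2 : k = box lam i c' h.2
    · simp [h2]
    rw [Equiv.swap_apply_of_ne_of_ne h1 h2]
  · rfl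

theorem col_boxSwap (a : Fin (∑ i, lam i) → Fin d) {i : Fin d} {c c' : ℕ} (hc : c < lam i)
    (hc' : c' < lam i) (hne : c ≠ c') (x : ℕ) :
    col lam (a ∘ boxSwap lam i c c') x =
      if x = c then Function.update (col lam a c) i (col lam a c' i)
      else if x = c' then Function.update (col lam a c') i (col lam a c i) else col lam a x := by
  have hb : boxSwap lam i c c' = Equiv.swap (box lam i c hc) (box lam i c' hc') :=
    dif_pos ⟨hc, hc'⟩
  have hother : ∀ k, boxRow lam k ≠ i ∨ (boxCol lam k ≠ c ∧ boxCol lam k ≠ c') →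
      boxSwap lam i c c' k = k := by
    intro k hk
    rw [hb]
    refine Equiv.swap_apply_of_ne_of_ne ?_ ?_
    · rintro rfl
      simp at hk
    · rintro rfl
      simp at hk
  funext r
  by_cases hx : x < lam r
  · rw [col_of_lt _ hx, Function.comp_apply]
    by_cases hr : r = i
    · subst hr
      by_cases h1 : x = c
      · subst h1
        simp [hb, col_of_lt a hc']
      by_cases h2 : x = c'
      · subst h2
        simp [hb, h1, col_of_lt a hc]
      · rw [hother _ (Or.inr (by simp [h1, h2]))]
        simp [h1, h2, col_of_lt a hx]
    · rw [hother _ (Or.inl (by simpa using hr))]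
      split_ifs with h1 h2
      · subst h1
        simp [hr, col_of_lt a hx]
      · subst h2
        simp [hr, col_of_lt a hx]
      · rw [col_of_lt a hx]
  · have hx' := not_lt.1 hx
    rw [col_of_le _ hx']
    have hr : x = c ∨ x = c' → r ≠ i := by
      rintro h rfl
      omega
    split_ifs with h1 h2
    · subst h1
      simp [hr, col_of_le a hx']
    · subst h2
      simp [hr, col_of_le a hx']
    · rw [col_of_le a hx']

theorem colInjective_iff {a : Fin (∑ i, lam i) → Fin d} :
    ColInjective lam a ↔ ∀ c r s, c < lam r → c < lam s → col lam a c r = col lam a c s → r = s := by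
  constructor
  · intro h c r s hr hs he
    rw [col_of_lt a hr, col_of_lt a hs] at he
    have := h _ _ (by simp) he
    simpa using congrArg (boxRow lam) this
  · intro h k l hc hv
    refine box_ext (h (boxCol lam k) _ _ (boxCol_lt k) (hc ▸ boxCol_lt l) ?_) hc
    rw [col_boxCol_boxRow, hv, hc, col_boxCol_boxRow]

theorem rowLength_coe (lam : Fin d → ℕ) (i : Fin d) : rowLength lam i = lam i := by
  simp [rowLength]

theorem le_rowLength_succ {K : ℕ} (hgap : ∀ i : Fin d, rowLength lam (i + 1) + K ≤ lam i)
    {i r : Fin d} (h : i < r) : lam r ≤ rowLength lam (i + 1) := by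
  have hanti : Antitone (rowLength lam) := by
    refine antitone_nat_of_succ_le fun k => ?_
    by_cases hk : k < d
    · have := hgap ⟨k, hk⟩
      rw [← rowLength_coe lam ⟨k, hk⟩] at this
      simp only at this
      omega
    · have : ¬ k + 1 < d := by omega
      simp [rowLength, this]
  rw [← rowLength_coe lam r]
  exact hanti (Nat.succ_le_of_lt (Fin.lt_def.1 h))

/-- The number of misplaced entries of a filling in excess of one in each nontrivial column. -/
def excess (lam : Fin d → ℕ) (a : Fin (∑ i, lam i) → Fin d) : ℕ :=
  ∑ c ∈ Finset.range (∑ i, lam i), (defect (col lam a c) - 1)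

open Classical in
/-- The fillings of `𝐦` of given excess, with distinct entries in each column. -/
def level (lam : Fin d → ℕ) (m : Occ d) (E : ℕ) : Finset (Fin (∑ i, lam i) → Fin d) :=
  (fillings lam m).filter fun a => ColInjective lam a ∧ excess lam a = E

theorem mem_level {m : Occ d} {E : ℕ} {a : Fin (∑ i, lam i) → Fin d} :
    a ∈ level lam m E ↔ a ∈ fillings lam m ∧ ColInjective lam a ∧ excess lam a = E := by
  simp [level]

/-- The trivial columns that end in row `i`. -/
def freshCols (lam : Fin d → ℕ) (a : Fin (∑ i, lam i) → Fin d) (i : Fin d) : Finset ℕ :=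
  (Finset.Ico (rowLength lam (i + 1)) (lam i)).filter fun c => col lam a c = id

theorem le_card_freshCols {m : Occ d} {K : ℕ}
    (hgap : ∀ i : Fin d, rowLength lam (i + 1) + (K + m.size) ≤ lam i)
    {a : Fin (∑ i, lam i) → Fin d} (ha : a ∈ fillings lam m) (i : Fin d) :
    K ≤ (freshCols lam a i).card := by
  have h1 := card_movedCols_le (fun i => by have := hgap i; omega) ha
  have h2 : Finset.Ico (rowLength lam (i + 1)) (lam i) ⊆ freshCols lam a i ∪ movedCols lam a := by
    intro c hc
    by_cases h : col lam a c = id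
    · exact Finset.mem_union_left _ (Finset.mem_filter.2 ⟨hc, h⟩)
    · exact Finset.mem_union_right _ (Finset.mem_filter.2 ⟨Finset.mem_range.2
        ((Finset.mem_Ico.1 hc).2.trans_le (row_le_sum i)), h⟩)
  have h3 := (Finset.card_le_card h2).trans (Finset.card_union_le _ _)
  rw [Nat.card_Ico] at h3
  have := hgap i
  omega

theorem defect_update_self {P : Fin d → Fin d} {i : Fin d} (hi : P i ≠ i) :
    defect (Function.update P i i) = defect P - 1 := by
  have : (Finset.univ.filter fun r => Function.update P i i r ≠ r) =
      (Finset.univ.filter fun r => P r ≠ r).erase i := by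
    ext r
    by_cases hr : r = i
    · subst hr; simp
    · simp [hr]
  rw [defect, this, Finset.card_erase_of_mem (by simpa using hi), defect]

theorem defect_update_id {i j : Fin d} (hj : j ≠ i) :
    defect (Function.update (id : Fin d → Fin d) i j) = 1 := by
  rw [defect, Finset.card_eq_one]
  refine ⟨i, ?_⟩
  ext r
  by_cases hr : r = i
  · subst hr; simpa using hj
  · simp [hr]

/-- The effect of moving the topmost misplaced entry of a column with several misplaced entries
to a fresh trivial column. -/
theorem boxSwap_mem_level {m : Occ d} {K E : ℕ}
    (hgap : ∀ i : Fin d, rowLength lam (i + 1) + K ≤ lam i)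
    {a : Fin (∑ i, lam i) → Fin d} (ha : a ∈ level lam m (E + 1)) {c c' : ℕ} {i : Fin d}
    (hc : 2 ≤ defect (col lam a c)) (hi : col lam a c i ≠ i)
    (hmin : ∀ r, r < i → col lam a c r = r) (hc' : c' ∈ freshCols lam a i) :
    a ∘ boxSwap lam i c c' ∈ level lam m E ∧ c ∈ movedCols lam (a ∘ boxSwap lam i c c') ∧
      c' ∈ movedCols lam (a ∘ boxSwap lam i c c') ∧
      col lam (a ∘ boxSwap lam i c c') c' = Function.update id i (col lam a c i) := by
  obtain ⟨ha1, ha2, ha3⟩ := mem_level.1 ha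
  have hdom := dominates_of_mem_fillings ha1
  obtain ⟨hc1, hc2⟩ := Finset.mem_filter.1 hc'
  rw [Finset.mem_Ico] at hc1
  have hci : c < lam i := by
    by_contra h
    exact hi (col_of_le a (not_lt.1 h))
  have hne : c ≠ c' := by
    rintro rfl
    exact hi (by rw [hc2]; rfl)
  have hgt : i < col lam a c i := lt_of_le_of_ne (hdom.le_col c i) hi.symm
  have hcol := col_boxSwap a hci hc1.2 hne
  have hcolc : col lam (a ∘ boxSwap lam i c c') c = Function.update (col lam a c) i i := by
    rw [hcol, if_pos rfl, hc2, id]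
  have hcolc' : col lam (a ∘ boxSwap lam i c c') c' = Function.update id i (col lam a c i) := by
    rw [hcol, if_neg hne.symm, if_pos rfl, hc2]
  have hcN : c ∈ Finset.range (∑ i, lam i) := Finset.mem_range.2 (hci.trans_le (row_le_sum i))
  have hcN' : c' ∈ Finset.range (∑ i, lam i) :=
    Finset.mem_range.2 (hc1.2.trans_le (row_le_sum i))
  refine ⟨mem_level.2 ⟨comp_mem_rowOrbit ha1 (boxSwap_mem_rowPerms i c c'), ?_, ?_⟩, ?_, ?_,
    hcolc'⟩
  · rw [colInjective_iff] at ha2 ⊢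
    intro x r s hr hs he
    by_cases hxc : x = c
    · subst hxc
      rw [hcolc] at he
      -- The value `i` does not occur elsewhere in this column: the entries above are trivial, and
      -- those below are larger.
      have hval : ∀ t, t ≠ i → col lam a x t ≠ i := by
        intro t ht h
        rcases lt_or_gt_of_ne ht with h1 | h1
        · exact ht ((hmin t h1).symm.trans h)
        · exact absurd (hdom.le_col x t) (not_le.2 (h ▸ h1))
      by_cases hri : r = i <;> by_cases hsi : s = i
      · rw [hri, hsi]
      · subst hri
        simp only [Function.update_self, Function.update_of_ne hsi] at he
        exact absurd he.symm (hval s hsi)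
      · subst hsi
        simp only [Function.update_self, Function.update_of_ne hri] at he
        exact absurd he (hval r hri)
      · simp only [Function.update_of_ne hri, Function.update_of_ne hsi] at he
        exact ha2 x r s hr hs he
    by_cases hxc' : x = c'
    · subst hxc'
      rw [hcolc'] at he
      have hle : ∀ t, x < lam t → t ≤ i := by
        intro t ht
        by_contra h
        have := le_rowLength_succ hgap (not_le.1 h)
        omega
      by_cases hri : r = i <;> by_cases hsi : s = i
      · rw [hri, hsi]
      · subst hri
        simp only [Function.update_self, Function.update_of_ne hsi, id] at he
        exact absurd (hle s hs) (not_le.2 (he ▸ hgt))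
      · subst hsi
        simp only [Function.update_self, Function.update_of_ne hri, id] at he
        exact absurd (hle r hr) (not_le.2 (he ▸ hgt))
      · simpa only [Function.update_of_ne hri, Function.update_of_ne hsi, id] using he
    · rw [hcol, if_neg hxc, if_neg hxc'] at he
      exact ha2 x r s hr hs he
  · have hc'E : c' ∈ (Finset.range (∑ i, lam i)).erase c := Finset.mem_erase.2 ⟨hne.symm, hcN'⟩
    unfold excess at ha3 ⊢
    rw [← Finset.add_sum_erase _ _ hcN, ← Finset.add_sum_erase _ _ hc'E] at ha3 ⊢
    rw [hcolc, hcolc', defect_update_self hi, defect_update_id hi]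
    rw [hc2, defect_eq_zero.2 rfl] at ha3
    rw [Finset.sum_congr rfl (g := fun x => defect (col lam a x) - 1)]
    · omega
    · intro x hx
      have h1 := Finset.mem_erase.1 hx
      have h2 := Finset.mem_erase.1 h1.2
      rw [hcol, if_neg h2.1, if_neg h1.1]
  · refine Finset.mem_filter.2 ⟨hcN, ?_⟩
    rw [hcolc, ne_eq, ← defect_eq_zero, defect_update_self hi]
    omega
  · refine Finset.mem_filter.2 ⟨hcN', ?_⟩
    rw [hcolc', ne_eq, ← defect_eq_zero, defect_update_id hi]
    omega

theorem exists_two_le_defect {a : Fin (∑ i, lam i) → Fin d} {E : ℕ} (h : excess lam a = E + 1) :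
    ∃ c i, 2 ≤ defect (col lam a c) ∧ col lam a c i ≠ i ∧ ∀ r, r < i → col lam a c r = r := by
  obtain ⟨c, hc⟩ : ∃ c, 2 ≤ defect (col lam a c) := by
    by_contra! hno
    have : excess lam a = 0 := Finset.sum_eq_zero fun c _ => by have := hno c; omega
    omega
  have hne : (Finset.univ.filter fun r => col lam a c r ≠ r).Nonempty :=
    Finset.card_pos.1 (by unfold defect at hc; omega)
  refine ⟨c, Finset.min' _ hne, hc, (Finset.mem_filter.1 (Finset.min'_mem _ hne)).2, ?_⟩
  intro r hr
  by_contra h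
  exact absurd (Finset.min'_le _ r (Finset.mem_filter.2 ⟨Finset.mem_univ _, h⟩)) (not_le.2 hr)

theorem card_level_succ_mul_le {m : Occ d} {K : ℕ}
    (hgap : ∀ i : Fin d, rowLength lam (i + 1) + (K + m.size) ≤ lam i) (E : ℕ) :
    (level lam m (E + 1)).card * K ≤ (level lam m E).card * m.size ^ 2 := by
  have hm : ∀ i, m.size ≤ lam i := fun i => by have := hgap i; omega
  rcases (level lam m (E + 1)).eq_empty_or_nonempty with he | ⟨a₀, ha₀⟩
  · simp [he]
  have : Nonempty (Fin d) :=
    (exists_two_le_defect (mem_level.1 ha₀).2.2).elim fun _ h => h.elim fun i _ => ⟨i⟩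
  choose! c i hc hi hmin using fun (a : Fin (∑ i, lam i) → Fin d) (ha : excess lam a = E + 1) =>
    exists_two_le_defect ha
  have hstep : ∀ p ∈ (level lam m (E + 1)).sigma fun a => freshCols lam a (i a),
      p.1 ∘ boxSwap lam (i p.1) (c p.1) p.2 ∈ level lam m E ∧
      c p.1 ∈ movedCols lam (p.1 ∘ boxSwap lam (i p.1) (c p.1) p.2) ∧
      p.2 ∈ movedCols lam (p.1 ∘ boxSwap lam (i p.1) (c p.1) p.2) ∧
      col lam (p.1 ∘ boxSwap lam (i p.1) (c p.1) p.2) p.2 =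
        Function.update id (i p.1) (col lam p.1 (c p.1) (i p.1)) ∧
      col lam p.1 (c p.1) (i p.1) ≠ i p.1 := by
    rintro ⟨a, x⟩ hp
    obtain ⟨h1, h2⟩ := Finset.mem_sigma.1 hp
    have h3 := (mem_level.1 h1).2.2
    obtain ⟨h4, h5, h6, h7⟩ := boxSwap_mem_level hgap h1 (hc a h3) (hi a h3) (hmin a h3) h2
    exact ⟨h4, h5, h6, h7, hi a h3⟩
  calc (level lam m (E + 1)).card * K
      ≤ ((level lam m (E + 1)).sigma fun a => freshCols lam a (i a)).card := by
        rw [Finset.card_sigma, ← smul_eq_mul]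
        exact Finset.card_nsmul_le_sum _ _ _ fun a ha =>
          le_card_freshCols hgap (mem_level.1 ha).1 (i a)
    _ ≤ ((level lam m E).sigma fun a => movedCols lam a ×ˢ movedCols lam a).card := by
        refine Finset.card_le_card_of_injOn
          (fun p => ⟨p.1 ∘ boxSwap lam (i p.1) (c p.1) p.2, c p.1, p.2⟩) ?_ ?_
        · intro p hp
          obtain ⟨h1, h2, h3, -⟩ := hstep p hp
          exact Finset.mem_sigma.2 ⟨h1, Finset.mem_product.2 ⟨h2, h3⟩⟩
        · rintro ⟨a, x⟩ hp ⟨b, y⟩ hq he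
          obtain ⟨-, -, -, h4, h5⟩ := hstep _ hp
          obtain ⟨-, -, -, h4', h5'⟩ := hstep _ hq
          simp only [Sigma.mk.injEq, heq_eq_eq, Prod.mk.injEq] at he h4 h4' h5 h5'
          obtain ⟨he1, he2, rfl⟩ := he
          -- The row of the exchanged boxes is the nontrivial row of the fresh column.
          have hii : i a = i b := by
            by_contra hne
            apply h5
            have h6 := congrFun (h4.symm.trans ((congrArg (fun w => col lam w x) he1).trans h4'))
              (i a)
            simpa [hne] using h6
          have hab : a = b := by
            funext k
            have := congrFun he1 (boxSwap lam (i a) (c a) x k)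
            simp only [Function.comp_apply, boxSwap_boxSwap] at this
            rw [this, ← hii, ← he2, boxSwap_boxSwap]
          rw [hab]
    _ ≤ (level lam m E).card * m.size ^ 2 := by
        rw [Finset.card_sigma, ← smul_eq_mul]
        refine Finset.sum_le_card_nsmul _ _ _ fun a ha => ?_
        rw [Finset.card_product, sq]
        have := card_movedCols_le hm (mem_level.1 ha).1
        exact Nat.mul_le_mul this this

theorem card_level_mul_pow_le {m : Occ d} {K : ℕ}
    (hgap : ∀ i : Fin d, rowLength lam (i + 1) + (K + m.size) ≤ lam i) (E : ℕ) :
    (level lam m E).card * K ^ E ≤ (level lam m 0).card * (m.size ^ 2) ^ E := by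
  induction E with
  | zero => simp
  | succ E ih =>
    calc (level lam m (E + 1)).card * K ^ (E + 1)
        = (level lam m (E + 1)).card * K * K ^ E := by ring
      _ ≤ (level lam m E).card * m.size ^ 2 * K ^ E :=
          Nat.mul_le_mul_right _ (card_level_succ_mul_le hgap E)
      _ = (level lam m E).card * K ^ E * m.size ^ 2 := by ring
      _ ≤ (level lam m 0).card * (m.size ^ 2) ^ E * m.size ^ 2 := Nat.mul_le_mul_right _ ih
      _ = (level lam m 0).card * (m.size ^ 2) ^ (E + 1) := by ring

/-! ### Fillings with prescribed columns of large defect -/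

/-- For each column `P` with at least two misplaced entries, the number of times that it occurs
in the filling (and `0` for the other columns `P`). -/
def clusters (lam : Fin d → ℕ) (a : Fin (∑ i, lam i) → Fin d) (P : Fin d → Fin d) : ℕ :=
  if 2 ≤ defect P then ((Finset.range (∑ i, lam i)).filter fun c => col lam a c = P).card else 0

open Classical in
/-- The fillings of `𝐦` with distinct entries in each column and with prescribed clusters. -/
def part (lam : Fin d → ℕ) (m : Occ d) (κ : (Fin d → Fin d) → ℕ) :
    Finset (Fin (∑ i, lam i) → Fin d) :=
  (fillings lam m).filter fun a => ColInjective lam a ∧ clusters lam a = κ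

theorem mem_part {m : Occ d} {κ : (Fin d → Fin d) → ℕ} {a : Fin (∑ i, lam i) → Fin d} :
    a ∈ part lam m κ ↔ a ∈ fillings lam m ∧ ColInjective lam a ∧ clusters lam a = κ := by
  simp [part]

theorem excess_eq_sum_clusters (a : Fin (∑ i, lam i) → Fin d) :
    excess lam a = ∑ P, clusters lam a P * (defect P - 1) := by
  rw [excess, ← Finset.sum_fiberwise (Finset.range (∑ i, lam i)) (col lam a)]
  refine Finset.sum_congr rfl fun P _ => ?_
  rw [Finset.sum_congr rfl (g := fun _ => defect P - 1) fun c hc => by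
    rw [(Finset.mem_filter.1 hc).2], Finset.sum_const, smul_eq_mul]
  unfold clusters
  split_ifs with h
  · rfl
  · rw [show defect P - 1 = 0 by omega, mul_zero, mul_zero]

theorem sum_clusters_le_excess (a : Fin (∑ i, lam i) → Fin d) :
    ∑ P, clusters lam a P ≤ excess lam a := by
  rw [excess_eq_sum_clusters]
  refine Finset.sum_le_sum fun P _ => ?_
  unfold clusters
  split_ifs with h
  · exact Nat.le_mul_of_pos_right _ (by omega)
  · simp

theorem level_zero_eq_part (m : Occ d) : level lam m 0 = part lam m 0 := by
  ext a
  rw [mem_level, mem_part]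
  refine and_congr_right fun _ => and_congr_right fun _ => ⟨fun h => ?_, fun h => ?_⟩
  · have h1 := sum_clusters_le_excess a
    rw [h, Nat.le_zero, Finset.sum_eq_zero_iff] at h1
    exact funext fun P => h1 P (Finset.mem_univ P)
  · rw [excess_eq_sum_clusters, h]
    simp

theorem card_part_le_card_level {m : Occ d} (κ : (Fin d → Fin d) → ℕ) :
    (part lam m κ).card ≤ (level lam m (∑ P, κ P * (defect P - 1))).card := by
  refine Finset.card_le_card fun a ha => ?_
  obtain ⟨h1, h2, h3⟩ := mem_part.1 ha
  exact mem_level.2 ⟨h1, h2, by rw [excess_eq_sum_clusters, h3]⟩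

theorem col_eq_of_defect_le_one {a b : Fin (∑ i, lam i) → Fin d} (ha : Dominates lam a)
    (hb : Dominates lam b) (hab : SameContent lam a b) {c : ℕ}
    (ha1 : defect (col lam a c) ≤ 1) (hb1 : defect (col lam b c) ≤ 1) :
    col lam a c = col lam b c :=
  eq_of_content_eq (ha.le_col c) (hb.le_col c) ha1 hb1 (hab c)

/-- The columns of given content other than a column `P` with at most one misplaced entry are
counted by the clusters, so that the number of columns equal to `P` is determined. -/
theorem card_col_eq_of_sameContent {a b : Fin (∑ i, lam i) → Fin d} (ha : Dominates lam a)
    (hb : Dominates lam b) (hab : SameContent lam a b) (hκ : clusters lam a = clusters lam b)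
    (P : Fin d → Fin d) :
    ((Finset.range (∑ i, lam i)).filter fun c => col lam a c = P).card =
      ((Finset.range (∑ i, lam i)).filter fun c => col lam b c = P).card := by
  by_cases hP : 2 ≤ defect P
  · have := congrFun hκ P
    simpa [clusters, hP] using this
  by_cases hPd : ∀ r, r ≤ P r
  · have key : ∀ w : Fin (∑ i, lam i) → Fin d, Dominates lam w →
        ((Finset.range (∑ i, lam i)).filter fun c => col lam w c = P).card +
          ∑ P', (if content P' = content P then clusters lam w P' else 0) =
        ((Finset.range (∑ i, lam i)).filter fun c => content (col lam w c) = content P).card := by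
      intro w hw
      rw [Finset.card_eq_sum_card_fiberwise (t := Finset.univ) (f := col lam w)
        (s := (Finset.range (∑ i, lam i)).filter fun c => content (col lam w c) = content P)
        (fun _ _ => Finset.mem_coe.2 (Finset.mem_univ _)),
        ← Finset.add_sum_erase (a := P) Finset.univ
          (fun P' => if content P' = content P then clusters lam w P' else 0) (Finset.mem_univ P),
        ← Finset.add_sum_erase (a := P) Finset.univ _ (Finset.mem_univ P)]
      have h0 : clusters lam w P = 0 := by simp [clusters, hP]
      simp only [h0, if_true, zero_add]
      refine congrArg₂ (· + ·) (congrArg Finset.card ?_) ?_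
      · ext c
        simp only [Finset.mem_filter]
        constructor
        · rintro ⟨h1, h2⟩
          exact ⟨⟨h1, by rw [h2]⟩, h2⟩
        · rintro ⟨⟨h1, -⟩, h2⟩
          exact ⟨h1, h2⟩
      · refine Finset.sum_congr rfl fun P' hP' => ?_
        split_ifs with hc
        · unfold clusters
          split_ifs with h2
          · congr 1
            ext c
            simp only [Finset.mem_filter]
            constructor
            · rintro ⟨h3, h4⟩
              exact ⟨⟨h3, by rw [h4, hc]⟩, h4⟩
            · rintro ⟨⟨h3, -⟩, h4⟩
              exact ⟨h3, h4⟩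
          · symm
            rw [Finset.card_eq_zero, Finset.filter_eq_empty_iff]
            intro c _ h4
            refine (Finset.mem_erase.1 hP').1 (eq_of_content_eq ?_ hPd (by omega) (by omega) hc)
            rw [← h4]
            exact hw.le_col c
        · symm
          rw [Finset.card_eq_zero, Finset.filter_eq_empty_iff]
          intro c h3 h4
          exact hc (by rw [← h4, (Finset.mem_filter.1 h3).2])
    have h1 := key a ha
    have h2 := key b hb
    rw [hκ] at h1
    simp only [hab _] at h1
    omega
  · have h0 : ∀ w : Fin (∑ i, lam i) → Fin d, Dominates lam w →
        ((Finset.range (∑ i, lam i)).filter fun c => col lam w c = P).card = 0 := by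
      intro w hw
      rw [Finset.card_eq_zero, Finset.filter_eq_empty_iff]
      rintro c _ rfl
      exact hPd (hw.le_col c)
    rw [h0 a ha, h0 b hb]

theorem eq_of_mem_part {m l : Occ d} (hm : ∀ i, m.size ≤ lam i) (hl : ∀ i, l.size ≤ lam i)
    {κ : (Fin d → Fin d) → ℕ} {a b : Fin (∑ i, lam i) → Fin d} (ha : a ∈ part lam m κ)
    (hb : b ∈ part lam l κ) (hab : SameContent lam a b) : m = l := by
  obtain ⟨ha1, -, ha3⟩ := mem_part.1 ha
  obtain ⟨hb1, -, hb3⟩ := mem_part.1 hb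
  refine Occ.ext_entry fun i j hij => ?_
  have key : ∀ w : Fin (∑ i, lam i) → Fin d,
      ((Finset.range (∑ i, lam i)).filter fun c => col lam w c i = j).card =
        ∑ P : Fin d → Fin d, if P i = j then
          ((Finset.range (∑ i, lam i)).filter fun c => col lam w c = P).card else 0 := by
    intro w
    rw [Finset.card_eq_sum_card_fiberwise (t := Finset.univ) (f := col lam w)
      (fun _ _ => Finset.mem_coe.2 (Finset.mem_univ _))]
    refine Finset.sum_congr rfl fun P _ => ?_
    split_ifs with h
    · congr 1
      ext c
      simp only [Finset.mem_filter]
      constructor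
      · rintro ⟨⟨h1, -⟩, h2⟩
        exact ⟨h1, h2⟩
      · rintro ⟨h1, h2⟩
        exact ⟨⟨h1, by rw [h2, h]⟩, h2⟩
    · rw [Finset.card_eq_zero, Finset.filter_eq_empty_iff]
      intro c h1 h2
      exact h (by rw [← h2, (Finset.mem_filter.1 h1).2])
  rw [← card_col_eq_entry hm ha1 hij, ← card_col_eq_entry hl hb1 hij, key a, key b]
  refine Finset.sum_congr rfl fun P _ => ?_
  rw [card_col_eq_of_sameContent (dominates_of_mem_fillings ha1) (dominates_of_mem_fillings hb1)
    hab (ha3.trans hb3.symm) P]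

theorem defect_le_one_of_clusters_eq_zero {a : Fin (∑ i, lam i) → Fin d}
    (h : clusters lam a = 0) {c : ℕ} (hc : c ∈ Finset.range (∑ i, lam i)) :
    defect (col lam a c) ≤ 1 := by
  by_contra hgt
  have := congrFun h (col lam a c)
  simp only [clusters, Pi.zero_apply, if_pos (Nat.succ_le_of_lt (not_le.1 hgt)),
    Finset.card_eq_zero, Finset.filter_eq_empty_iff] at this
  exact this hc rfl

/-- A filling without clusters minimises the number of misplaced entries among the dominating
fillings with the same contents of the columns. -/
theorem eq_of_mem_part_zero {m : Occ d} (hm : ∀ i, m.size ≤ lam i)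
    {a b : Fin (∑ i, lam i) → Fin d} (ha : a ∈ part lam m 0) (hb : b ∈ fillings lam m)
    (hab : SameContent lam a b) : a = b := by
  obtain ⟨ha1, -, ha3⟩ := mem_part.1 ha
  have hda := dominates_of_mem_fillings ha1
  have hdb := dominates_of_mem_fillings hb
  have h1 := fun c (hc : c ∈ Finset.range (∑ i, lam i)) =>
    defect_le_one_of_clusters_eq_zero ha3 hc
  have h2 : ∀ c ∈ Finset.range (∑ i, lam i), defect (col lam a c) ≤ defect (col lam b c) := by
    intro c hc
    by_cases h0 : defect (col lam b c) = 0
    · have h3 := hab c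
      rw [defect_eq_zero.1 h0] at h3
      rw [eq_id_of_content_eq (hda.le_col c) h3, defect_eq_zero.2 rfl]
      exact Nat.zero_le _
    · have := h1 c hc
      omega
  have h3 := (Finset.sum_eq_sum_iff_of_le h2).1 ((sum_defect hm ha1).trans (sum_defect hm hb).symm)
  exact eq_of_col_eq fun c hc => col_eq_of_defect_le_one hda hdb hab (h1 c hc)
    ((h3 c hc).symm.le.trans (h1 c hc))

theorem eq_zero_of_sameContent {m : Occ d} (hm : ∀ i, m.size ≤ lam i)
    {a b : Fin (∑ i, lam i) → Fin d} (ha : a ∈ fillings lam 0) (hb : b ∈ fillings lam m)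
    (hab : SameContent lam a b) : m = 0 := by
  have h0 : (0 : Occ d).size = 0 := by simp [Occ.size]
  have h1 := sum_defect (m := 0) (fun i => h0.trans_le (Nat.zero_le _)) ha
  rw [h0, Finset.sum_eq_zero_iff] at h1
  have h2 := sum_defect hm hb
  rw [Finset.sum_eq_zero] at h2
  · funext p
    exact (Finset.sum_eq_zero_iff.1 h2.symm) p (Finset.mem_univ p)
  · intro c hc
    have h3 := hab c
    rw [defect_eq_zero.1 (h1 c hc)] at h3
    rw [eq_id_of_content_eq ((dominates_of_mem_fillings hb).le_col c) h3.symm,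
      defect_eq_zero.2 rfl]

open Classical in
/-- A filling is determined by the contents of its columns and the positions of its clusters, and
these positions are among the nontrivial columns. -/
theorem card_sameContent_le {m : Occ d} (hm : ∀ i, m.size ≤ lam i) {κ : (Fin d → Fin d) → ℕ}
    {a : Fin (∑ i, lam i) → Fin d} (ha : a ∈ part lam m κ) :
    ((part lam m κ).filter fun b => SameContent lam a b).card ≤ m.size ^ ∑ P, κ P := by
  obtain ⟨ha1, -, -⟩ := mem_part.1 ha
  have hda := dominates_of_mem_fillings ha1
  calc ((part lam m κ).filter fun b => SameContent lam a b).card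
      ≤ (Fintype.piFinset fun P => (movedCols lam a).powersetCard (κ P)).card := by
        refine Finset.card_le_card_of_injOn (fun b P => (Finset.range (∑ i, lam i)).filter
          fun c => 2 ≤ defect P ∧ col lam b c = P) ?_ ?_
        · intro b hb
          obtain ⟨hb1, hb2⟩ := Finset.mem_filter.1 hb
          obtain ⟨-, -, hb3⟩ := mem_part.1 hb1
          refine Fintype.mem_piFinset.2 fun P => Finset.mem_powersetCard.2 ⟨?_, ?_⟩
          · intro c hc
            obtain ⟨h1, h2, h3⟩ := Finset.mem_filter.1 hc
            refine Finset.mem_filter.2 ⟨h1, fun h4 => ?_⟩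
            have h5 := hb2 c
            rw [h4] at h5
            have h6 := eq_id_of_content_eq
              ((dominates_of_mem_fillings (mem_part.1 hb1).1).le_col c) h5.symm
            rw [h3] at h6
            rw [defect_eq_zero.2 h6] at h2
            omega
          · rw [← hb3]
            unfold clusters
            by_cases hP : 2 ≤ defect P <;> simp [hP]
        · intro b hb b' hb' he
          obtain ⟨hb1, hb2⟩ := Finset.mem_filter.1 hb
          obtain ⟨hb1', hb2'⟩ := Finset.mem_filter.1 hb'
          refine eq_of_col_eq fun c hc => ?_
          have h1 : ∀ P, 2 ≤ defect P → (col lam b c = P ↔ col lam b' c = P) := by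
            intro P hP
            have := congrArg (fun s => c ∈ s) (congrFun he P)
            simpa [Finset.mem_range.1 hc, hP] using this
          by_cases h2 : 2 ≤ defect (col lam b c)
          · exact ((h1 _ h2).1 rfl).symm
          by_cases h3 : 2 ≤ defect (col lam b' c)
          · exact (h1 _ h3).2 rfl
          exact col_eq_of_defect_le_one (dominates_of_mem_fillings (mem_part.1 hb1).1)
            (dominates_of_mem_fillings (mem_part.1 hb1').1)
            (fun c => (hb2 c).symm.trans (hb2' c)) (by omega) (by omega)
    _ = ∏ P, (movedCols lam a).card.choose (κ P) := by
        simp [Fintype.card_piFinset, Finset.card_powersetCard]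
    _ ≤ ∏ P, m.size ^ κ P := by
        refine Finset.prod_le_prod' fun P _ => ?_
        exact (Nat.choose_le_pow _ _).trans
          (Nat.pow_le_pow_left (card_movedCols_le hm ha1) _)
    _ = m.size ^ ∑ P, κ P := Finset.prod_pow_eq_pow_sum _ _ _

theorem card_part_mul_le {m : Occ d} {K : ℕ}
    (hgap : ∀ i : Fin d, rowLength lam (i + 1) + (K + m.size) ≤ lam i) {q : ℝ} (hq : q ≤ 1)
    (hK : 0 < K) (hmK : (m.size : ℝ) ^ 3 ≤ q * K) (κ : (Fin d → Fin d) → ℕ) :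
    ((part lam m κ).card : ℝ) * (m.size : ℝ) ^ ∑ P, κ P ≤
      q ^ (∑ P, κ P) * (part lam m 0).card := by
  have hK' : (0 : ℝ) < K := by exact_mod_cast hK
  have hq0 : 0 ≤ q := by
    by_contra h
    have : (0 : ℝ) ≤ (m.size : ℝ) ^ 3 := by positivity
    nlinarith
  rcases (part lam m κ).eq_empty_or_nonempty with he | ⟨a, ha⟩
  · rw [he]
    simp only [Finset.card_empty, Nat.cast_zero, zero_mul]
    positivity
  have hE : ∑ P, κ P ≤ ∑ P, κ P * (defect P - 1) := by
    rw [← (mem_part.1 ha).2.2, ← excess_eq_sum_clusters]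
    exact sum_clusters_le_excess a
  set E := ∑ P, κ P * (defect P - 1) with hEdef
  set s := ∑ P, κ P
  have h1 : ((part lam m κ).card : ℝ) * (K : ℝ) ^ E ≤
      (part lam m 0).card * ((m.size : ℝ) ^ 2) ^ E := by
    have h := card_level_mul_pow_le hgap E
    rw [level_zero_eq_part] at h
    have h' : (part lam m κ).card * K ^ E ≤ (part lam m 0).card * (m.size ^ 2) ^ E :=
      (Nat.mul_le_mul_right _ (card_part_le_card_level κ)).trans h
    exact_mod_cast h'
  have h2 : ((part lam m κ).card : ℝ) ≤
      (part lam m 0).card * ((m.size : ℝ) ^ 2 / K) ^ E := by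
    rw [div_pow, mul_div_assoc', le_div_iff₀ (by positivity)]
    exact h1
  have hsq : (m.size : ℝ) ^ 2 ≤ (m.size : ℝ) ^ 3 := by
    rcases Nat.eq_zero_or_pos m.size with h0 | h0
    · simp [h0]
    · exact_mod_cast Nat.pow_le_pow_right h0 (by norm_num)
  have h3 : ((m.size : ℝ) ^ 2 / K) ^ E ≤ ((m.size : ℝ) ^ 2 / K) ^ s := by
    refine pow_le_pow_of_le_one (by positivity) ?_ hE
    rw [div_le_one hK']
    nlinarith
  calc ((part lam m κ).card : ℝ) * (m.size : ℝ) ^ s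
      ≤ (part lam m 0).card * ((m.size : ℝ) ^ 2 / K) ^ s * (m.size : ℝ) ^ s := by
        gcongr
        exact h2.trans (by gcongr)
    _ = ((m.size : ℝ) ^ 3 / K) ^ s * (part lam m 0).card := by
        rw [mul_assoc, ← mul_pow, mul_comm]
        congr 2
        ring
    _ ≤ q ^ s * (part lam m 0).card := by
        gcongr
        rwa [div_le_iff₀ hK']

/-! ### The vectors `y_λ f_𝐦` -/

/-- The contribution to `y_λ f_𝐦` of the fillings with prescribed clusters. -/
def partVec (lam : Fin d → ℕ) (m : Occ d) (κ : (Fin d → Fin d) → ℕ) : TensorPow d (∑ i, lam i) :=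
  ∑ a ∈ part lam m κ, colAntisym lam (basisVec a)

/-- The vector `y_λ f_𝐦`, up to a positive factor: each filling is counted once. -/
def fillingVec (lam : Fin d → ℕ) (m : Occ d) : TensorPow d (∑ i, lam i) :=
  ∑ a ∈ fillings lam m, colAntisym lam (basisVec a)

theorem exists_youngVec_eq (m : Occ d) :
    ∃ M : ℕ, 0 < M ∧ (youngVec lam m : TensorPow d (∑ i, lam i)) = (M : ℂ) • fillingVec lam m := by
  obtain ⟨M, hM, h⟩ := exists_rowSym_basisVec (tableauWord lam m)
  refine ⟨M, hM, ?_⟩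
  change colAntisym lam (rowSym lam (basisVec (tableauWord lam m))) = _
  rw [h, map_smul, map_sum]
  rfl

theorem coe_ket (m : Occ d) : (ket lam m : TensorPow d (∑ i, lam i)) =
    ((‖fillingVec lam m‖⁻¹ : ℝ) : ℂ) • fillingVec lam m := by
  obtain ⟨M, hM, h⟩ := exists_youngVec_eq (lam := lam) m
  have hM' : (M : ℂ) ≠ 0 := by exact_mod_cast hM.ne'
  rw [ket, Submodule.coe_smul, Submodule.coe_norm, h, norm_smul, smul_smul]
  congr 1
  simp only [Complex.norm_natCast, mul_inv, Complex.ofReal_mul, Complex.ofReal_inv,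
    Complex.ofReal_natCast]
  field_simp

theorem clusters_le (a : Fin (∑ i, lam i) → Fin d) (P : Fin d → Fin d) :
    clusters lam a P ≤ ∑ i, lam i := by
  unfold clusters
  split_ifs
  · exact (Finset.card_filter_le _ _).trans (Finset.card_range _).le
  · exact Nat.zero_le _

theorem fillingVec_eq_sum (m : Occ d) : fillingVec lam m =
    ∑ κ ∈ Fintype.piFinset fun _ => Finset.range (∑ i, lam i + 1), partVec lam m κ := by
  classical
  rw [fillingVec, ← Finset.sum_filter_of_ne (p := ColInjective lam)]
  · rw [← Finset.sum_fiberwise_of_maps_to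
      (t := Fintype.piFinset fun _ => Finset.range (∑ i, lam i + 1)) (g := clusters lam)]
    · refine Finset.sum_congr rfl fun κ _ => Finset.sum_congr ?_ fun _ _ => rfl
      ext a
      rw [mem_part, Finset.mem_filter, Finset.mem_filter, and_assoc]
    · intro a _
      exact Fintype.mem_piFinset.2 fun P => Finset.mem_range.2 (Nat.lt_succ_of_le (clusters_le a P))
  · intro a _ h
    by_contra hc
    exact h (colAntisym_eq_zero hc)

theorem inner_partVec_eq_zero {m l : Occ d} (hm : ∀ i, m.size ≤ lam i) (hl : ∀ i, l.size ≤ lam i)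
    (hne : m ≠ l) (κ : (Fin d → Fin d) → ℕ) :
    inner ℂ (partVec lam m κ) (partVec lam l κ) = 0 := by
  rw [partVec, partVec, sum_inner]
  refine Finset.sum_eq_zero fun a ha => ?_
  rw [inner_sum]
  exact Finset.sum_eq_zero fun b hb => inner_colAntisym_eq_zero fun h =>
    hne (eq_of_mem_part hm hl ha hb h)

theorem norm_sq_partVec_le {m : Occ d} (hm : ∀ i, m.size ≤ lam i) (κ : (Fin d → Fin d) → ℕ) :
    ‖partVec lam m κ‖ ^ 2 ≤
      (colPerms lam).card * ((part lam m κ).card * (m.size : ℝ) ^ ∑ P, κ P) := by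
  classical
  have hnorm : ∀ a ∈ part lam m κ, ‖colAntisym lam (basisVec a)‖ =
      √((colPerms lam).card : ℝ) := by
    intro a ha
    rw [← norm_sq_colAntisym (mem_part.1 ha).2.1, Real.sqrt_sq (norm_nonneg _)]
  have h1 : ‖partVec lam m κ‖ ^ 2 = ‖(inner ℂ (partVec lam m κ) (partVec lam m κ) : ℂ)‖ := by
    rw [inner_self_eq_norm_sq_to_K]
    simp
  calc ‖partVec lam m κ‖ ^ 2
      = ‖∑ a ∈ part lam m κ, ∑ b ∈ part lam m κ,
          (inner ℂ (colAntisym lam (basisVec a)) (colAntisym lam (basisVec b)) : ℂ)‖ := by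
        rw [h1, partVec, sum_inner]
        simp only [inner_sum]
    _ ≤ ∑ a ∈ part lam m κ, ∑ b ∈ part lam m κ,
          if SameContent lam a b then ((colPerms lam).card : ℝ) else 0 := by
        refine norm_sum_le_of_le _ fun a ha => norm_sum_le_of_le _ fun b hb => ?_
        split_ifs with h
        · refine (norm_inner_le_norm _ _).trans ?_
          rw [hnorm a ha, hnorm b hb, Real.mul_self_sqrt (Nat.cast_nonneg _)]
        · rw [inner_colAntisym_eq_zero h, norm_zero]
    _ ≤ ∑ _a ∈ part lam m κ, (m.size : ℝ) ^ (∑ P, κ P) * (colPerms lam).card := by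
        refine Finset.sum_le_sum fun a ha => ?_
        rw [← Finset.sum_filter, Finset.sum_const, nsmul_eq_mul]
        gcongr
        exact_mod_cast card_sameContent_le hm ha
    _ = _ := by
        rw [Finset.sum_const, nsmul_eq_mul]
        ring

theorem card_mul_card_part_zero_le {m : Occ d} (hm : ∀ i, m.size ≤ lam i) :
    ((colPerms lam).card : ℝ) * (part lam m 0).card ≤ ‖fillingVec lam m‖ ^ 2 := by
  have h1 : (inner ℂ (partVec lam m 0) (fillingVec lam m) : ℂ) =
      (colPerms lam).card * (part lam m 0).card := by
    rw [partVec, fillingVec, sum_inner, mul_comm, ← nsmul_eq_mul, ← Finset.sum_const]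
    refine Finset.sum_congr rfl fun a ha => ?_
    obtain ⟨ha1, ha2, -⟩ := mem_part.1 ha
    rw [inner_sum, Finset.sum_eq_single_of_mem a ha1, inner_colAntisym_self ha2]
    intro b hb hba
    exact inner_colAntisym_eq_zero fun h => hba (eq_of_mem_part_zero hm ha hb h).symm
  have h2 := norm_sq_partVec_le hm 0
  simp only [Pi.zero_apply, Finset.sum_const_zero, pow_zero, mul_one] at h2
  have h3 := norm_inner_le_norm (𝕜 := ℂ) (partVec lam m 0) (fillingVec lam m)
  rw [h1] at h3
  set X : ℝ := ((colPerms lam).card : ℝ) * (part lam m 0).card with hX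
  have hX0 : 0 ≤ X := by positivity
  have h4 : ‖((colPerms lam).card * (part lam m 0).card : ℂ)‖ = X := by simp [hX]
  rw [h4] at h3
  have h5 : X ^ 2 ≤ X * ‖fillingVec lam m‖ ^ 2 := by
    calc X ^ 2 ≤ (‖partVec lam m 0‖ * ‖fillingVec lam m‖) ^ 2 := by gcongr
      _ = ‖partVec lam m 0‖ ^ 2 * ‖fillingVec lam m‖ ^ 2 := by ring
      _ ≤ X * ‖fillingVec lam m‖ ^ 2 := by gcongr
  rcases hX0.eq_or_lt with h | h
  · rw [← h]; positivity
  · rw [sq] at h5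
    exact le_of_mul_le_mul_left h5 h

theorem norm_partVec_le {m : Occ d} {K : ℕ}
    (hgap : ∀ i : Fin d, rowLength lam (i + 1) + (K + m.size) ≤ lam i) {z : ℝ} (hz0 : 0 ≤ z)
    (hz : z ≤ 1) (hK : 0 < K) (hmK : (m.size : ℝ) ^ 3 ≤ z ^ 2 * K) (κ : (Fin d → Fin d) → ℕ) :
    ‖partVec lam m κ‖ ≤ z ^ (∑ P, κ P) * ‖fillingVec lam m‖ := by
  have hm : ∀ i, m.size ≤ lam i := fun i => by have := hgap i; omega
  refine le_of_sq_le_sq ?_ (by positivity)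
  calc ‖partVec lam m κ‖ ^ 2
      ≤ (colPerms lam).card * ((part lam m κ).card * (m.size : ℝ) ^ ∑ P, κ P) :=
        norm_sq_partVec_le hm κ
    _ ≤ (colPerms lam).card * ((z ^ 2) ^ (∑ P, κ P) * (part lam m 0).card) := by
        refine mul_le_mul_of_nonneg_left ?_ (Nat.cast_nonneg _)
        exact card_part_mul_le hgap (pow_le_one₀ hz0 hz) hK hmK κ
    _ = (z ^ 2) ^ (∑ P, κ P) * ((colPerms lam).card * (part lam m 0).card) := by ring
    _ ≤ (z ^ 2) ^ (∑ P, κ P) * ‖fillingVec lam m‖ ^ 2 := by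
        gcongr
        exact card_mul_card_part_zero_le hm
    _ = (z ^ (∑ P, κ P) * ‖fillingVec lam m‖) ^ 2 := by ring

theorem inner_ket_zero {m : Occ d} (hm : ∀ i, m.size ≤ lam i) (hne : m ≠ 0) :
    inner ℂ (ket lam 0) (ket lam m) = 0 := by
  rw [Submodule.coe_inner, coe_ket, coe_ket, inner_smul_left, inner_smul_right]
  refine mul_eq_zero_of_right _ (mul_eq_zero_of_right _ ?_)
  rw [fillingVec, fillingVec, sum_inner]
  refine Finset.sum_eq_zero fun a ha => ?_
  rw [inner_sum]
  exact Finset.sum_eq_zero fun b hb => inner_colAntisym_eq_zero fun h =>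
    hne (eq_zero_of_sameContent hm ha hb h)

theorem norm_ket_zero : ‖ket lam 0‖ = 1 := by
  have h0 : (0 : Occ d).size = 0 := by simp [Occ.size]
  have hm : ∀ i, (0 : Occ d).size ≤ lam i := fun i => h0.trans_le (Nat.zero_le _)
  have hmem : tableauWord lam 0 ∈ fillings lam 0 := self_mem_rowOrbit _
  have h1 := sum_defect hm hmem
  rw [h0, Finset.sum_eq_zero_iff] at h1
  have h2 : tableauWord lam 0 ∈ part lam 0 0 := by
    rw [← level_zero_eq_part]
    refine mem_level.2 ⟨hmem, ?_, Finset.sum_eq_zero fun c hc => by simp [h1 c hc]⟩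
    rw [colInjective_iff]
    intro c r s hr _ he
    rw [defect_eq_zero.1 (h1 c (Finset.mem_range.2 (hr.trans_le (row_le_sum r))))] at he
    exact he
  have h3 := card_mul_card_part_zero_le hm
  have h4 : 0 < (part lam 0 0).card := Finset.card_pos.2 ⟨_, h2⟩
  have h5 : 0 < (colPerms lam).card := Finset.card_pos.2 ⟨1, by simp [mem_colPerms]⟩
  have h6 : (0 : ℝ) < (colPerms lam).card * (part lam 0 0).card := by positivity
  have h7 : ‖fillingVec lam 0‖ ≠ 0 := by
    intro h
    rw [h] at h3
    norm_num at h3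
    linarith
  rw [Submodule.coe_norm, coe_ket, norm_smul, Complex.norm_real, norm_inv, norm_norm,
    inv_mul_cancel₀ h7]

theorem norm_sq_sum_of_orthogonal {E ι : Type*} [NormedAddCommGroup E] [InnerProductSpace ℂ E]
    (S : Finset ι) (v : ι → E) (h : ∀ i ∈ S, ∀ j ∈ S, i ≠ j → inner ℂ (v i) (v j) = 0) :
    ‖∑ i ∈ S, v i‖ ^ 2 = ∑ i ∈ S, ‖v i‖ ^ 2 := by
  apply Complex.ofReal_injective
  have h1 := inner_self_eq_norm_sq_to_K (𝕜 := ℂ) (∑ i ∈ S, v i)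
  rw [Complex.ofReal_pow]
  refine h1.symm.trans ?_
  rw [sum_inner, Complex.ofReal_sum]
  refine Finset.sum_congr rfl fun i hi => ?_
  rw [inner_sum, Finset.sum_eq_single_of_mem i hi fun j hj hji => h i hi j hj hji.symm,
    Complex.ofReal_pow]
  exact inner_self_eq_norm_sq_to_K (v i)

theorem sum_pow_sum_le {ι : Type*} [Fintype ι] [DecidableEq ι] {z : ℝ} (hz0 : 0 ≤ z) (hz : z < 1)
    (N : ℕ) :
    ∑ κ ∈ Fintype.piFinset fun _ : ι => Finset.range N, z ^ (∑ P, κ P) ≤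
      ((1 - z)⁻¹) ^ Fintype.card ι := by
  calc ∑ κ ∈ Fintype.piFinset fun _ : ι => Finset.range N, z ^ (∑ P, κ P)
      = ∏ _P : ι, ∑ j ∈ Finset.range N, z ^ j := by
        rw [Finset.prod_univ_sum]
        exact Finset.sum_congr rfl fun κ _ => (Finset.prod_pow_eq_pow_sum _ _ _).symm
    _ = (∑ j ∈ Finset.range N, z ^ j) ^ Fintype.card ι := by
        rw [Finset.prod_const, Finset.card_univ]
    _ ≤ ((1 - z)⁻¹) ^ Fintype.card ι := by
        refine pow_le_pow_left₀ (Finset.sum_nonneg fun j _ => pow_nonneg hz0 j) ?_ _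
        rw [← tsum_geometric_of_lt_one hz0 hz]
        exact (summable_geometric_of_lt_one hz0 hz).sum_le_tsum _ fun j _ => pow_nonneg hz0 j

/-- The family of the vectors `|𝐦, λ⟩` is close to being orthonormal: its synthesis operator is
bounded by the sum over the clusters `κ` of the bounds `z ^ |κ|` for the parts of the vectors. -/
theorem norm_sum_ket_le {K : ℕ} {z : ℝ} (hz0 : 0 ≤ z) (hz : z < 1) (hK : 0 < K)
    (S : Finset (Occ d))
    (hgap : ∀ m ∈ S, ∀ i : Fin d, rowLength lam (i + 1) + (K + m.size) ≤ lam i)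
    (hmK : ∀ m ∈ S, (m.size : ℝ) ^ 3 ≤ z ^ 2 * K) (b : Occ d → ℂ) :
    ‖∑ m ∈ S, b m • ket lam m‖ ≤
      ((1 - z)⁻¹) ^ Fintype.card (Fin d → Fin d) * √(∑ m ∈ S, ‖b m‖ ^ 2) := by
  have hm : ∀ m ∈ S, ∀ i, m.size ≤ lam i := fun m hmS i => by have := hgap m hmS i; omega
  have h1 : ((∑ m ∈ S, b m • ket lam m : Irrep lam) : TensorPow d (∑ i, lam i)) =
      ∑ κ ∈ Fintype.piFinset fun _ => Finset.range (∑ i, lam i + 1),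
        ∑ m ∈ S, (b m * ((‖fillingVec lam m‖⁻¹ : ℝ) : ℂ)) • partVec lam m κ := by
    rw [Finset.sum_comm, Submodule.coe_sum]
    refine Finset.sum_congr rfl fun m _ => ?_
    rw [Submodule.coe_smul, coe_ket, smul_smul, ← Finset.smul_sum, ← fillingVec_eq_sum]
  rw [Submodule.coe_norm, h1]
  refine (norm_sum_le_of_le _ (fun κ _ => ?_) : _ ≤ ∑ κ ∈ Fintype.piFinset fun _ =>
    Finset.range (∑ i, lam i + 1), z ^ (∑ P, κ P) * √(∑ m ∈ S, ‖b m‖ ^ 2)).trans ?_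
  · refine le_of_sq_le_sq ?_ (by positivity)
    rw [norm_sq_sum_of_orthogonal, mul_pow,
      Real.sq_sqrt (Finset.sum_nonneg fun _ _ => by positivity), Finset.mul_sum]
    · refine Finset.sum_le_sum fun m hmS => ?_
      rw [norm_smul, norm_mul, Complex.norm_real, norm_inv, norm_norm, mul_assoc, mul_pow,
        mul_comm]
      gcongr
      rw [inv_mul_eq_div]
      exact div_le_of_le_mul₀ (norm_nonneg _) (by positivity)
        (norm_partVec_le (hgap m hmS) hz0 hz.le hK (hmK m hmS) κ)
    · intro m hmS l hlS hne
      rw [inner_smul_left, inner_smul_right, inner_partVec_eq_zero (hm m hmS) (hm l hlS) hne,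
        mul_zero, mul_zero]
  · rw [← Finset.sum_mul]
    gcongr
    exact sum_pow_sum_le hz0 hz _

/-! ### Isometries into the Fock space -/

section Isometry

variable {H : Type*} [NormedAddCommGroup H] [InnerProductSpace ℂ H] {ι : Type*}

/-- Bessel's inequality for a unit vector `u₀` and a family that is orthogonal to it and whose
synthesis operator has norm at most `√B`. -/
theorem norm_sq_inner_add_sum_le {S : Finset ι} {u : ι → H} {u₀ : H} (hu₀ : ‖u₀‖ = 1)
    (horth : ∀ i ∈ S, inner ℂ u₀ (u i) = 0) {B : ℝ} (hB : 0 < B)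
    (h : ∀ b : ι → ℂ, ‖∑ i ∈ S, b i • u i‖ ^ 2 ≤ B * ∑ i ∈ S, ‖b i‖ ^ 2) (ψ : H) :
    ‖inner ℂ u₀ ψ‖ ^ 2 + B⁻¹ * ∑ i ∈ S, ‖inner ℂ (u i) ψ‖ ^ 2 ≤ ‖ψ‖ ^ 2 := by
  set c : ℂ := inner ℂ u₀ ψ with hc
  set φ : H := ψ - c • u₀ with hφ
  have hself : inner ℂ u₀ u₀ = (1 : ℂ) := by
    rw [inner_self_eq_norm_sq_to_K, hu₀]; simp
  have h0 : inner ℂ (c • u₀) φ = (0 : ℂ) := by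
    rw [hφ, inner_smul_left, inner_sub_right, inner_smul_right, hself, ← hc]
    ring
  have h1 : ‖ψ‖ ^ 2 = ‖c‖ ^ 2 + ‖φ‖ ^ 2 := by
    have : ψ = c • u₀ + φ := by rw [hφ]; abel
    have h2 := norm_add_sq_eq_norm_sq_add_norm_sq_of_inner_eq_zero (𝕜 := ℂ) (c • u₀) φ h0
    rw [← this, norm_smul, hu₀, mul_one] at h2
    linarith
  set s : ℝ := ∑ i ∈ S, ‖inner ℂ (u i) ψ‖ ^ 2 with hs
  have hs0 : 0 ≤ s := Finset.sum_nonneg fun _ _ => by positivity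
  set x : H := ∑ i ∈ S, (inner ℂ (u i) ψ : ℂ) • u i with hx
  have h3 : (inner ℂ x φ : ℂ) = s := by
    rw [hx, sum_inner, hs, Complex.ofReal_sum]
    refine Finset.sum_congr rfl fun i hi => ?_
    have : (inner ℂ (u i) u₀ : ℂ) = 0 := inner_eq_zero_symm.1 (horth i hi)
    rw [inner_smul_left, hφ, inner_sub_right, inner_smul_right, this, mul_zero, sub_zero,
      Complex.conj_mul', Complex.ofReal_pow]
  have h4 : s ≤ ‖x‖ * ‖φ‖ := by
    have := norm_inner_le_norm (𝕜 := ℂ) x φ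
    rwa [h3, Complex.norm_real, Real.norm_of_nonneg hs0] at this
  have h5 : s * s ≤ s * (B * ‖φ‖ ^ 2) := by
    calc s * s ≤ (‖x‖ * ‖φ‖) * (‖x‖ * ‖φ‖) := by gcongr
      _ = ‖x‖ ^ 2 * ‖φ‖ ^ 2 := by ring
      _ ≤ (B * s) * ‖φ‖ ^ 2 := by gcongr; exact h _
      _ = s * (B * ‖φ‖ ^ 2) := by ring
  have h6 : B⁻¹ * s ≤ ‖φ‖ ^ 2 := by
    rw [inv_mul_le_iff₀ hB]
    rcases hs0.eq_or_lt with h | h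
    · rw [← h]; positivity
    · exact le_of_mul_le_mul_left h5 h
  linarith

/-- A finite family of functionals whose squares add up to the squared norm provides an isometry
into the square summable families. -/
theorem exists_isometry_of_sum_eq [DecidableEq ι] {α : Type*} [Fintype α] (e : α ↪ ι)
    (L : α → H →ₗ[ℂ] ℂ) (hL : ∀ ψ, ∑ a, ‖L a ψ‖ ^ 2 = ‖ψ‖ ^ 2) :
    ∃ V : H →ₗᵢ[ℂ] lp (fun _ : ι => ℂ) 2, ∀ a ψ,
      inner ℂ (lp.single 2 (e a) (1 : ℂ) : lp (fun _ : ι => ℂ) 2) (V ψ) = L a ψ := by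
  have hinner : ∀ i j (x : ℂ), inner ℂ (lp.single 2 i (1 : ℂ) : lp (fun _ : ι => ℂ) 2)
      (lp.single 2 j x : lp (fun _ : ι => ℂ) 2) = if i = j then x else 0 := by
    intro i j x
    rw [lp.inner_single_left, lp.single_apply]
    by_cases h : i = j
    · subst h; simp
    · simp [h]
  let V₀ : H →ₗ[ℂ] lp (fun _ : ι => ℂ) 2 :=
    { toFun := fun ψ => ∑ a, lp.single 2 (e a) (L a ψ)
      map_add' := fun ψ φ => by simp [lp.single_add, Finset.sum_add_distrib]
      map_smul' := fun c ψ => by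
        simp only [map_smul, lp.single_smul, Finset.smul_sum, RingHom.id_apply] }
  have hV₀ : ∀ ψ, V₀ ψ = ∑ a, lp.single 2 (e a) (L a ψ) := fun _ => rfl
  refine ⟨⟨V₀, fun ψ => ?_⟩, fun a ψ => ?_⟩
  · rw [← sq_eq_sq₀ (norm_nonneg _) (norm_nonneg _), ← hL, hV₀, norm_sq_sum_of_orthogonal]
    · refine Finset.sum_congr rfl fun a _ => ?_
      rw [lp.norm_single (by norm_num)]
    · intro a _ b _ hab
      rw [lp.inner_single_left, lp.single_apply]
      simp [e.injective.ne hab]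
  · change inner ℂ _ (V₀ ψ) = _
    rw [hV₀, inner_sum, Finset.sum_eq_single_of_mem a (Finset.mem_univ a), hinner, if_pos rfl]
    intro b _ hb
    rw [hinner, if_neg (e.injective.ne hb.symm)]

/-- A contraction `ψ ↦ (⟨w i, ψ⟩)` on finitely many coordinates extends to an isometry: the
diagonalisation of its defect operator provides the functionals for the spare coordinates. -/
theorem exists_isometry_of_sum_le [FiniteDimensional ℂ H] [DecidableEq ι] [Infinite ι]
    (S : Finset ι) (w : ι → H) (hw : ∀ ψ, ∑ i ∈ S, ‖inner ℂ (w i) ψ‖ ^ 2 ≤ ‖ψ‖ ^ 2) :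
    ∃ V : H →ₗᵢ[ℂ] lp (fun _ : ι => ℂ) 2, ∀ i ∈ S, ∀ ψ,
      inner ℂ (lp.single 2 i (1 : ℂ) : lp (fun _ : ι => ℂ) 2) (V ψ) = inner ℂ (w i) ψ := by
  let T : H →ₗ[ℂ] H :=
    LinearMap.id - ∑ i ∈ S, (innerₛₗ ℂ (w i)).smulRight (w i)
  have hT : ∀ ψ, T ψ = ψ - ∑ i ∈ S, (inner ℂ (w i) ψ : ℂ) • w i := by
    intro ψ
    simp [T]
  have hTψ : ∀ ψ, (inner ℂ ψ (T ψ) : ℂ) =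
      ((‖ψ‖ ^ 2 - ∑ i ∈ S, ‖inner ℂ (w i) ψ‖ ^ 2 : ℝ) : ℂ) := by
    intro ψ
    rw [hT, inner_sub_right, inner_self_eq_norm_sq_to_K, inner_sum, Complex.ofReal_sub,
      Complex.ofReal_sum, Complex.ofReal_pow]
    congr 1
    refine Finset.sum_congr rfl fun i _ => ?_
    rw [inner_smul_right, ← inner_conj_symm ψ (w i), Complex.mul_conj', Complex.ofReal_pow]
  have hsymm : T.IsSymmetric := by
    intro ψ φ
    rw [hT, hT, inner_sub_left, inner_sub_right, sum_inner, inner_sum]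
    congr 1
    refine Finset.sum_congr rfl fun i _ => ?_
    rw [inner_smul_left, inner_smul_right, inner_conj_symm, mul_comm]
  let b := hsymm.eigenvectorBasis rfl
  let μ := hsymm.eigenvalues rfl
  have hTb : ∀ j ψ, (inner ℂ (b j) (T ψ) : ℂ) = μ j * inner ℂ (b j) ψ := by
    intro j ψ
    rw [← hsymm (b j) ψ, hsymm.apply_eigenvectorBasis rfl j, inner_smul_left]
    simp [b, μ]
  have hμ : ∀ j, 0 ≤ μ j := by
    intro j
    have h1 := hTb j (b j)
    rw [hTψ, inner_self_eq_norm_sq_to_K, b.orthonormal.1 j] at h1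
    have h2 : ‖b j‖ ^ 2 - ∑ i ∈ S, ‖inner ℂ (w i) (b j)‖ ^ 2 = μ j := by
      apply Complex.ofReal_injective
      rw [b.orthonormal.1 j, h1]
      simp
    rw [← h2]
    exact sub_nonneg.2 (hw _)
  have : Infinite ↥((S : Set ι)ᶜ) := (S.finite_toSet.infinite_compl).to_subtype
  let g := Infinite.natEmbedding ↥((S : Set ι)ᶜ)
  let e : S ⊕ Fin (Module.finrank ℂ H) ↪ ι :=
    ⟨Sum.elim Subtype.val fun j => (g j : ι), by
      rintro (i | j) (i' | j') h
      · exact congrArg Sum.inl (Subtype.ext h)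
      · have h' : (i : ι) = g j' := h
        exact absurd (h' ▸ i.2) (g j').2
      · have h' : (g j : ι) = i' := h
        exact absurd (h' ▸ i'.2) (g j).2
      · exact congrArg Sum.inr (Fin.ext (g.injective (Subtype.ext h)))⟩
  obtain ⟨V, hV⟩ := exists_isometry_of_sum_eq (H := H) e
    (Sum.elim (fun i => innerₛₗ ℂ (w i)) fun j => ((√(μ j) : ℝ) : ℂ) • innerₛₗ ℂ (b j)) (by
      intro ψ
      have h1 : ∑ j, (μ j * ‖inner ℂ (b j) ψ‖ ^ 2) =
          ‖ψ‖ ^ 2 - ∑ i ∈ S, ‖inner ℂ (w i) ψ‖ ^ 2 := by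
        apply Complex.ofReal_injective
        rw [← hTψ, ← b.sum_inner_mul_inner ψ (T ψ), Complex.ofReal_sum]
        refine Finset.sum_congr rfl fun j _ => ?_
        rw [hTb, ← inner_conj_symm ψ (b j), mul_left_comm, Complex.conj_mul', Complex.ofReal_mul,
          Complex.ofReal_pow]
      rw [Fintype.sum_sum_type]
      simp only [Sum.elim_inl, Sum.elim_inr, LinearMap.smul_apply, innerₛₗ_apply_apply, norm_smul,
        Complex.norm_real, Real.norm_of_nonneg (Real.sqrt_nonneg _), mul_pow,
        Real.sq_sqrt (hμ _)]
      rw [h1, Finset.sum_coe_sort S fun i => ‖inner ℂ (w i) ψ‖ ^ 2]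
      ring)
  exact ⟨V, fun i hi ψ => hV (Sum.inl ⟨i, hi⟩) ψ⟩

end Isometry

theorem norm_inner_eq_of_one (lam : Fin 1 → ℕ) (φ ψ : Irrep lam) :
    ‖inner ℂ φ ψ‖ = ‖φ‖ * ‖ψ‖ := by
  have hnorm : ∀ x : TensorPow 1 (∑ i, lam i), ‖x‖ = ‖x default‖ := by
    intro x
    rw [EuclideanSpace.norm_eq, Fintype.sum_unique, Real.sqrt_sq (norm_nonneg _)]
  rw [Submodule.coe_inner, PiLp.inner_apply, Fintype.sum_unique, Submodule.coe_norm,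
    Submodule.coe_norm, hnorm, hnorm]
  simp [mul_comm]

theorem eq_number_of_inner {x : Fock d} {m : Occ d} (hx : ‖x‖ = 1)
    (h : inner ℂ (Fock.number m) x = (1 : ℂ)) : x = Fock.number m := by
  have h1 : ‖Fock.number m‖ = 1 := by
    rw [Fock.number, lp.norm_single (by norm_num)]
    simp
  exact ((inner_eq_one_iff_of_norm_eq_one h1 hx).1 h).symm

/-- A bound on the synthesis operator of the vectors `|𝐦, λ⟩` other than the vacuum provides the
isometry into the Fock space. -/
theorem exists_isometry_fock (hd : 0 < d) (S : Finset (Occ d)) (h0 : 0 ∈ S)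
    (hS : ∀ m ∈ S, ∀ i, m.size ≤ lam i) {B : ℝ} (hB : 0 < B)
    (h : ∀ b : Occ d → ℂ, ‖∑ m ∈ S.erase 0, b m • ket lam m‖ ^ 2 ≤
      B * ∑ m ∈ S.erase 0, ‖b m‖ ^ 2) :
    ∃ V : Irrep lam →ₗᵢ[ℂ] Fock d, V (ket lam 0) = Fock.number 0 ∧
      ∀ m ∈ S, m ≠ 0 → ∀ ψ, inner ℂ (Fock.number m) (V ψ) =
        ((1 / √B : ℝ) : ℂ) * inner ℂ (ket lam m) ψ := by
  have hself : (inner ℂ (ket lam 0) (ket lam 0) : ℂ) = 1 := by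
    refine (inner_self_eq_norm_sq_to_K (𝕜 := ℂ) (ket lam 0)).trans ?_
    rw [norm_ket_zero]
    simp
  suffices hV : ∃ V : Irrep lam →ₗᵢ[ℂ] Fock d,
      (∀ ψ, inner ℂ (Fock.number 0) (V ψ) = (inner ℂ (ket lam 0) ψ : ℂ)) ∧
      ∀ m ∈ S, m ≠ 0 → ∀ ψ, inner ℂ (Fock.number m) (V ψ) =
        ((1 / √B : ℝ) : ℂ) * inner ℂ (ket lam m) ψ by
    obtain ⟨V, h1, h2⟩ := hV
    refine ⟨V, eq_number_of_inner ?_ ?_, h2⟩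
    · rw [V.norm_map, norm_ket_zero]
    · rw [h1, hself]
  obtain rfl | hd2 : d = 1 ∨ 2 ≤ d := by omega
  · -- There are no modes, and the space is a line.
    obtain ⟨V, hV⟩ := exists_isometry_of_sum_eq (H := Irrep lam) (ι := Occ 1) (α := Unit)
      ⟨fun _ => 0, fun _ _ _ => rfl⟩ (fun _ => innerₛₗ ℂ (ket lam 0)) (by
        intro ψ
        have h1 := norm_inner_eq_of_one lam (ket lam 0) ψ
        rw [norm_ket_zero, one_mul] at h1
        rw [Fintype.sum_unique]
        exact congrArg (· ^ 2) h1)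
    refine ⟨V, fun ψ => hV () ψ, fun m _ hm => absurd ?_ hm⟩
    funext ⟨⟨i, j⟩, hij⟩
    exact absurd (Subsingleton.elim i j) hij.ne
  · have : Nonempty (Mode d) :=
      ⟨⟨(⟨0, by omega⟩, ⟨1, by omega⟩), Fin.lt_def.2 Nat.zero_lt_one⟩⟩
    let w : Occ d → Irrep lam :=
      fun m => if m = 0 then ket lam 0 else ((1 / √B : ℝ) : ℂ) • ket lam m
    have hw0 : w 0 = ket lam 0 := if_pos rfl
    have hwm : ∀ m, m ≠ 0 → ∀ ψ, (inner ℂ (w m) ψ : ℂ) =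
        ((1 / √B : ℝ) : ℂ) * inner ℂ (ket lam m) ψ := by
      intro m hm ψ
      simp only [w, if_neg hm]
      refine (inner_smul_left (𝕜 := ℂ) (ket lam m) ψ _).trans ?_
      rw [Complex.conj_ofReal]
    obtain ⟨V, hV⟩ := exists_isometry_of_sum_le S w (by
      intro ψ
      rw [← Finset.add_sum_erase _ _ h0, hw0]
      refine le_of_eq_of_le ?_ (norm_sq_inner_add_sum_le (u := ket lam) norm_ket_zero
        (fun m hm => inner_ket_zero (hS m (Finset.mem_of_mem_erase hm))
          (Finset.ne_of_mem_erase hm)) hB h ψ)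
      rw [Finset.mul_sum]
      congr 1
      refine Finset.sum_congr rfl fun m hm => ?_
      rw [hwm m (Finset.ne_of_mem_erase hm), norm_mul, Complex.norm_real, mul_pow, Real.norm_eq_abs,
        sq_abs, div_pow, Real.sq_sqrt hB.le, one_pow, one_div])
    refine ⟨V, fun ψ => ?_, fun m hm hm0 ψ => ?_⟩
    · rw [← hw0]
      exact hV 0 h0 ψ
    · rw [← hwm m hm0]
      exact hV m hm ψ

/-! ### Estimates of the constants -/

theorem inv_one_sub_pow_sq_le {D : ℕ} {z : ℝ} (hz0 : 0 ≤ z) (hz1 : z ≤ 1) (hz : 4 * D * z ≤ 1) :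
    (((1 - z)⁻¹) ^ D) ^ 2 ≤ 1 + 4 * D * z := by
  have h1 : 1 - 2 * D * z ≤ ((1 - z) ^ D) ^ 2 := by
    have := one_add_mul_le_pow (a := -z) (by linarith) (D * 2)
    rw [← pow_mul]
    push_cast at this
    calc 1 - 2 * D * z = 1 + D * 2 * -z := by ring
      _ ≤ (1 + -z) ^ (D * 2) := this
      _ = (1 - z) ^ (D * 2) := by ring
  have hD : 0 ≤ (D : ℝ) * z := by positivity
  rw [inv_pow, inv_pow]
  refine inv_le_of_inv_le₀ (by positivity) (le_trans ?_ h1)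
  rw [inv_le_iff_one_le_mul₀ (by positivity)]
  nlinarith

theorem finite_size_le (d k : ℕ) : {m : Occ d | m.size ≤ k}.Finite := by
  refine (Set.Finite.pi' fun _ : Mode d => Set.finite_Iic k).subset fun m hm p => ?_
  exact (Finset.single_le_sum (f := m) (fun _ _ => Nat.zero_le _) (Finset.mem_univ p)).trans hm

theorem eq_zero_of_size_eq_zero {m : Occ d} (h : m.size = 0) : m = 0 :=
  funext fun p => Finset.sum_eq_zero_iff.1 h p (Finset.mem_univ p)

theorem floor_half_le_ceil {x : ℝ} (hx : 0 ≤ x) : ⌊x / 2⌋₊ ≤ ⌈x⌉₊ :=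
  (Nat.floor_le_ceil _).trans (Nat.ceil_mono (by linarith))

theorem size_pow_three_le {n : ℕ} {η : ℝ} (hn0 : (0 : ℝ) < n) {m : Occ d}
    (hm : (m.size : ℝ) ≤ (n : ℝ) ^ η) : (m.size : ℝ) ^ 3 ≤ (n : ℝ) ^ (3 * η - 1) * n := by
  calc (m.size : ℝ) ^ 3 ≤ ((n : ℝ) ^ η) ^ 3 := by gcongr
    _ = (n : ℝ) ^ (3 * η - 1) * n := by
      rw [← Real.rpow_natCast, ← Real.rpow_mul hn0.le, ← Real.rpow_add_one hn0.ne']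
      congr 1
      push_cast
      ring

/-- The misplaced entries occupy at most half of each gap between consecutive row lengths. -/
theorem size_le_floor {n : ℕ} {η δ : ℝ} (hδ : 0 < δ) (hδ1 : δ ≤ 1) (hn0 : (0 : ℝ) < n)
    (hn : 32 / δ ^ 2 < (n : ℝ) ^ (1 - 3 * η)) {m : Occ d} (hm : (m.size : ℝ) ≤ (n : ℝ) ^ η) :
    m.size ≤ ⌊δ * n / 2⌋₊ := by
  refine Nat.le_floor ?_
  have h1 : (m.size : ℝ) ≤ (m.size : ℝ) ^ 3 := by
    exact_mod_cast Nat.le_self_pow (by norm_num) m.size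
  have hy0 : 0 < (n : ℝ) ^ (3 * η - 1) := Real.rpow_pos_of_pos hn0 _
  have h2 : (n : ℝ) ^ (1 - 3 * η) * (n : ℝ) ^ (3 * η - 1) = 1 := by
    rw [← Real.rpow_add hn0]
    norm_num
  have h3 : 32 * (n : ℝ) ^ (3 * η - 1) ≤ δ ^ 2 := by
    rw [div_lt_iff₀ (by positivity)] at hn
    nlinarith
  have h4 : (n : ℝ) ^ (3 * η - 1) ≤ δ / 2 := by nlinarith
  calc (m.size : ℝ) ≤ (n : ℝ) ^ (3 * η - 1) * n := h1.trans (size_pow_three_le hn0 hm)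
    _ ≤ δ / 2 * n := by gcongr
    _ = δ * n / 2 := by ring

/-- The spectral bound in terms of `n`, `δ` and `η`. -/
theorem norm_sum_ket_sq_le {n : ℕ} {η δ : ℝ} (hη0 : 0 ≤ η) (hδ : 0 < δ)
    (hδ1 : δ ≤ 1) (hn1 : 1 < (n : ℝ))
    (hn : 32 * (Fintype.card (Fin d → Fin d) : ℝ) ^ 2 / δ ^ 2 < (n : ℝ) ^ (1 - 3 * η))
    (hgap : ∀ i : Fin d, rowLength lam (i + 1) + ⌈δ * n⌉₊ ≤ lam i) (S : Finset (Occ d))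
    (hS : ∀ m ∈ S, (m.size : ℝ) ≤ (n : ℝ) ^ η) (b : Occ d → ℂ) :
    ‖∑ m ∈ S, b m • ket lam m‖ ^ 2 ≤
      (1 + 8 * Fintype.card (Fin d → Fin d) * (n : ℝ) ^ ((9 * η - 2) / 12) / δ ^ (1 / 3 : ℝ)) *
        ∑ m ∈ S, ‖b m‖ ^ 2 := by
  set D := Fintype.card (Fin d → Fin d) with hDdef
  have hD : (1 : ℝ) ≤ D := by
    exact_mod_cast Fintype.card_pos_iff.2 ⟨(id : Fin d → Fin d)⟩
  have hn0 : (0 : ℝ) < n := by linarith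
  set y : ℝ := (n : ℝ) ^ (3 * η - 1) with hy
  have hy0 : 0 < y := Real.rpow_pos_of_pos hn0 _
  set x : ℝ := (n : ℝ) ^ ((3 * η - 1) / 2) / δ with hx
  have hx0 : 0 < x := div_pos (Real.rpow_pos_of_pos hn0 _) hδ
  have hx2 : x ^ 2 = y / δ ^ 2 := by
    rw [hx, div_pow, hy, ← Real.rpow_natCast, ← Real.rpow_mul hn0.le]
    norm_num
  have hxs : 32 * (D : ℝ) ^ 2 * x ^ 2 < 1 := by
    have h1 : (n : ℝ) ^ (1 - 3 * η) * y = 1 := by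
      rw [hy, ← Real.rpow_add hn0]
      norm_num
    rw [hx2]
    calc 32 * (D : ℝ) ^ 2 * (y / δ ^ 2) = 32 * (D : ℝ) ^ 2 / δ ^ 2 * y := by ring
      _ < (n : ℝ) ^ (1 - 3 * η) * y := by gcongr
      _ = 1 := h1
  have hx1 : x ≤ 1 := by
    by_contra hlt
    have : 1 < x ^ 2 := one_lt_pow₀ (not_le.1 hlt) two_ne_zero
    nlinarith
  set z : ℝ := √(2 * y / δ) with hz
  have hz0 : 0 ≤ z := Real.sqrt_nonneg _
  have hz2 : z ^ 2 = 2 * y / δ := Real.sq_sqrt (by positivity)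
  have hzx : z ^ 2 ≤ 2 * x ^ 2 := by
    rw [hz2, hx2, mul_div_assoc]
    gcongr
    nlinarith
  have hDz : 4 * D * z < 1 := by
    refine lt_of_pow_lt_pow_left₀ 2 zero_le_one ?_
    nlinarith
  have hz1 : z < 1 := by nlinarith
  have hzx' : z ≤ 2 * x := by
    refine le_of_sq_le_sq ?_ (by positivity)
    nlinarith
  -- At least half of the gap is kept free of misplaced entries.
  have hcube : ∀ m ∈ S, (m.size : ℝ) ^ 3 ≤ y * n := fun m hm => size_pow_three_le hn0 (hS m hm)
  have hn32 : 32 / δ ^ 2 < (n : ℝ) ^ (1 - 3 * η) := by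
    refine lt_of_le_of_lt ?_ hn
    gcongr
    nlinarith
  have hhalf : ∀ m ∈ S, m.size ≤ ⌊δ * n / 2⌋₊ := fun m hm =>
    size_le_floor hδ hδ1 hn0 hn32 (hS m hm)
  set K : ℕ := ⌈δ * n⌉₊ - ⌊δ * n / 2⌋₊ with hK
  have hfc : ⌊δ * n / 2⌋₊ ≤ ⌈δ * n⌉₊ := floor_half_le_ceil (by positivity)
  have hKle : δ * n / 2 ≤ K := by
    rw [hK, Nat.cast_sub hfc]
    have h1 := Nat.le_ceil (δ * n)
    have h2 := Nat.floor_le (a := δ * n / 2) (by positivity)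
    linarith
  have hK0 : 0 < K := by
    have : (0 : ℝ) < K := lt_of_lt_of_le (by positivity) hKle
    exact_mod_cast this
  have hmain := norm_sum_ket_le (lam := lam) hz0 hz1 hK0 S
    (fun m hm i => by
      have h1 := hhalf m hm
      have h2 := hgap i
      omega)
    (fun m hm => (hcube m hm).trans (by
      rw [hz2]
      calc y * n = 2 * y / δ * (δ * n / 2) := by field_simp
        _ ≤ 2 * y / δ * K := by gcongr)) b
  have hsum : 0 ≤ ∑ m ∈ S, ‖b m‖ ^ 2 := Finset.sum_nonneg fun _ _ => by positivity
  -- The deviation `x` is at most one, so that it is bounded by its cube root.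
  have hroot : x ≤ (n : ℝ) ^ ((9 * η - 2) / 12) / δ ^ (1 / 3 : ℝ) := by
    calc x = x ^ (1 : ℝ) := (Real.rpow_one x).symm
      _ ≤ x ^ (1 / 3 : ℝ) := Real.rpow_le_rpow_of_exponent_ge hx0 hx1 (by norm_num)
      _ = (n : ℝ) ^ ((3 * η - 1) / 2 * (1 / 3)) / δ ^ (1 / 3 : ℝ) := by
        rw [hx, Real.div_rpow (Real.rpow_nonneg hn0.le _) hδ.le, ← Real.rpow_mul hn0.le]
      _ ≤ (n : ℝ) ^ ((9 * η - 2) / 12) / δ ^ (1 / 3 : ℝ) := by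
        gcongr
        · exact hn1.le
        · linarith
  calc ‖∑ m ∈ S, b m • ket lam m‖ ^ 2
      ≤ (((1 - z)⁻¹) ^ D * √(∑ m ∈ S, ‖b m‖ ^ 2)) ^ 2 := by gcongr
    _ = (((1 - z)⁻¹) ^ D) ^ 2 * ∑ m ∈ S, ‖b m‖ ^ 2 := by rw [mul_pow, Real.sq_sqrt hsum]
    _ ≤ (1 + 4 * D * z) * ∑ m ∈ S, ‖b m‖ ^ 2 := by
        gcongr
        exact inv_one_sub_pow_sq_le hz0 hz1.le hDz.le
    _ ≤ _ := by
        gcongr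
        calc 4 * D * z ≤ 4 * D * (2 * x) := by gcongr
          _ = 8 * D * x := by ring
          _ ≤ 8 * D * ((n : ℝ) ^ ((9 * η - 2) / 12) / δ ^ (1 / 3 : ℝ)) := by gcongr
          _ = _ := by ring

end SchurWeylFock

end

theorem lemma5 (d : ℕ) :
    ∃ C : ℝ, 0 < C ∧ ∀ η : ℝ, η < 2 / 9 → ∃ Ct : ℝ, 0 < Ct ∧
      ∀ δ : ℝ, 0 < δ → ∀ n : ℕ, (C / δ ^ 2) ^ (1 / (1 - 3 * η)) < (n : ℝ) →
        ∀ lam : Fin d → ℕ, ∑ i, lam i = n →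
          (∀ i < d, δ * (n : ℝ) ≤
            (SchurWeylFock.rowLength lam i : ℝ) - (SchurWeylFock.rowLength lam (i + 1) : ℝ)) →
          ∃ V : SchurWeylFock.Irrep lam →ₗᵢ[ℂ] SchurWeylFock.Fock d,
            V (SchurWeylFock.ket lam 0) = SchurWeylFock.Fock.number 0 ∧
            ∀ m : SchurWeylFock.Occ d, m ≠ 0 → (m.size : ℝ) ≤ (n : ℝ) ^ η →
              ∀ ψ : SchurWeylFock.Irrep lam,
                inner ℂ (SchurWeylFock.Fock.number m) (V ψ) =
                  ((1 / √(1 + (Ct * (n : ℝ)) ^ ((9 * η - 2) / 12) / δ ^ (1 / 3 : ℝ)) : ℝ) : ℂ) *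
                    inner ℂ (SchurWeylFock.ket lam m) ψ := by
  open SchurWeylFock in
  set D := Fintype.card (Fin d → Fin d) with hDdef
  have hD : (1 : ℝ) ≤ D := by
    exact_mod_cast Fintype.card_pos_iff.2 ⟨(id : Fin d → Fin d)⟩
  refine ⟨32 * (D : ℝ) ^ 2, by positivity, fun η hη => ?_⟩
  set p : ℝ := (9 * η - 2) / 12 with hp
  have hp0 : p ≠ 0 := by
    rw [hp]
    intro h
    linarith
  refine ⟨(8 * (D : ℝ)) ^ (1 / p), by positivity, fun δ hδ n hn lam hlam hgap => ?_⟩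
  have hbase : 0 ≤ 32 * (D : ℝ) ^ 2 / δ ^ 2 := by positivity
  have hn0 : (0 : ℝ) < n := (Real.rpow_nonneg hbase _).trans_lt hn
  have hd : 0 < d := by
    rcases Nat.eq_zero_or_pos d with rfl | h
    · simp at hlam
      rw [← hlam] at hn0
      simp at hn0
    · exact h
  have ht : 0 < 1 - 3 * η := by linarith
  have hn' : 32 * (D : ℝ) ^ 2 / δ ^ 2 < (n : ℝ) ^ (1 - 3 * η) := by
    have := Real.rpow_lt_rpow (Real.rpow_nonneg hbase _) hn ht
    rwa [← Real.rpow_mul hbase, one_div_mul_cancel ht.ne', Real.rpow_one] at this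
  have hδ1 : δ ≤ 1 := by
    have h1 := hgap 0 hd
    have h2 : (rowLength lam ((⟨0, hd⟩ : Fin d) : ℕ) : ℝ) ≤ n := by
      rw [rowLength_coe, ← hlam]
      exact_mod_cast row_le_sum _
    have h3 : (0 : ℝ) ≤ rowLength lam (0 + 1) := Nat.cast_nonneg _
    have h4 : δ * n ≤ 1 * n := by
      simp only at h2
      linarith
    exact le_of_mul_le_mul_right h4 hn0
  have hn1 : 1 < (n : ℝ) := by
    by_contra hle
    have h1 : (n : ℝ) ^ (1 - 3 * η) ≤ 1 := Real.rpow_le_one hn0.le (not_lt.1 hle) ht.le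
    have h2 : 1 ≤ 32 * (D : ℝ) ^ 2 / δ ^ 2 := by
      rw [one_le_div (by positivity)]
      nlinarith
    linarith
  have hgap' : ∀ i : Fin d, rowLength lam (i + 1) + ⌈δ * n⌉₊ ≤ lam i := by
    intro i
    have h1 := hgap i i.2
    rw [rowLength_coe] at h1
    have h2 : rowLength lam (i + 1) ≤ lam i := by
      have : (0 : ℝ) ≤ δ * n := by positivity
      have h3 : (rowLength lam (i + 1) : ℝ) ≤ lam i := by linarith
      exact_mod_cast h3
    have h4 : ⌈δ * n⌉₊ ≤ lam i - rowLength lam (i + 1) := by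
      rw [Nat.ceil_le, Nat.cast_sub h2]
      exact h1
    omega
  have hfactor : ((8 * (D : ℝ)) ^ (1 / p) * n) ^ p = 8 * D * (n : ℝ) ^ p := by
    rw [Real.mul_rpow (by positivity) hn0.le, ← Real.rpow_mul (by positivity),
      one_div_mul_cancel hp0, Real.rpow_one]
  rw [hfactor]
  set S := (finite_size_le d ⌊(n : ℝ) ^ η⌋₊).toFinset with hS
  have hmemS : ∀ m : Occ d, m ∈ S ↔ (m.size : ℝ) ≤ (n : ℝ) ^ η := by
    intro m
    rw [hS, Set.Finite.mem_toFinset, Set.mem_ofPred_eq, Nat.le_floor_iff (by positivity)]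
  have h0S : (0 : Occ d) ∈ S := by
    rw [hmemS]
    simp only [Occ.size, Pi.zero_apply, Finset.sum_const_zero, Nat.cast_zero]
    positivity
  have hB : 0 < 1 + 8 * D * (n : ℝ) ^ p / δ ^ (1 / 3 : ℝ) := by positivity
  have hbound : ∀ b : Occ d → ℂ, ‖∑ m ∈ S.erase 0, b m • ket lam m‖ ^ 2 ≤
      (1 + 8 * D * (n : ℝ) ^ p / δ ^ (1 / 3 : ℝ)) * ∑ m ∈ S.erase 0, ‖b m‖ ^ 2 := by
    intro b
    rcases le_or_gt 0 η with hη0 | hη0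
    · exact norm_sum_ket_sq_le hη0 hδ hδ1 hn1 hn' hgap' _
        (fun m hm => (hmemS m).1 (Finset.mem_of_mem_erase hm)) b
    · -- For negative `η`, the bound on `|𝐦|` leaves the vacuum only.
      have hempty : S.erase 0 = ∅ := by
        refine Finset.eq_empty_of_forall_notMem fun m hm => ?_
        have h1 := ((hmemS m).1 (Finset.mem_of_mem_erase hm)).trans_lt
          (Real.rpow_lt_one_of_one_lt_of_neg hn1 hη0)
        have h2 : m.size < 1 := by exact_mod_cast h1
        exact Finset.ne_of_mem_erase hm (eq_zero_of_size_eq_zero (by omega))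
      rw [hempty]
      simp
  have hsize : ∀ m ∈ S, ∀ i, m.size ≤ lam i := by
    intro m hm i
    have hn32 : 32 / δ ^ 2 < (n : ℝ) ^ (1 - 3 * η) := by
      refine lt_of_le_of_lt ?_ hn'
      gcongr
      nlinarith
    have h1 := size_le_floor hδ hδ1 hn0 hn32 ((hmemS m).1 hm)
    have h2 := floor_half_le_ceil (x := δ * n) (by positivity)
    have h3 := hgap' i
    omega
  obtain ⟨V, hV0, hV⟩ := exists_isometry_fock hd S h0S hsize hB hbound
  exact ⟨V, hV0, fun m hm hmn ψ => hV m ((hmemS m).2 hmn) hm ψ⟩
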